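/- Let $q\ge 2$ and $\Sigma_q=\{0,1,\dots,q-1\}$. For $\mathbf x\in\Sigma_q^n$ let $\mathcal B^{\rm SD}_q(\mathbf x)$ be the set of all words obtained from $\mathbf x$ by at most one substitution or by exactly one deletion. For a code $\mathcal C\subseteq\Sigma_q^n$ put $$\nu(\mathcal C;\mathcal B^{\rm SD}_q)=\max\{|\mathcal B^{\rm SD}_q(\mathbf x)\cap \mathcal B^{\rm SD}_q(\mathbf y)| : \mathbf x,\mathbf y\in\mathcal C,\ \mathbf x\neq\mathbf y\}$$ (equal to $0$ if $|\mathcal C|\le 1$), and for $N\ge 1$ let $$\rho(n,N;\mathcal B^{\rm SD}_q)=\min\{\,n-\log_q|\mathcal C| : \emptyset\ne\mathcal C\subseteq\Sigma_q^n,\ \nu(\mathcal C;\mathcal B^{\rm SD}_q)<N\,\}.$$ The asymptotic notation refers to $n\to\infty$ with $q$ and $N$ fixed; $\rho=f(n)+\Theta(1)$ means that $f(n)-\epsilon(n)\le\rho\le f(n)+\epsilon(n)$ for all large $n$, for some $\epsilon(n)=\Theta(1)$. The exact statements hold for every $n\ge 1$. If $q=2$, then $$\rho(n,N;\mathcal B^{\rm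 SD}_2)=\begin{cases}\log_2 n+\Theta(1), & N\in\{1,2\},\\ \log_2\log_2 n+\Theta(1), & N=3,\\ 1-o(1), & N=4,\\ 0, & N\ge 5,\end{cases}$$ where in the case $N=4$ the term $o(1)$ is nonnegative, i.e. $\rho(n,4;\mathcal B^{\rm SD}_2)\le 1$. If $q\ge 3$, then $$\rho(n,N;\mathcal B^{\rm SD}_q)=\begin{cases}\log_q n+O(\log_q\log_q n), & N\in\{1,2\},\\ \log_q\log_q n+\Theta(1), & N=3,\\ 2-\epsilon(n), & N=4,\\ 1, & 5\le N\le q+1,\\ 0, & N\ge q+2,\end{cases}$$ where $0\le\epsilon(n)\le 1$. -/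

import Mathlib

open Filter Asymptotics

/-- Words of length `n` over the alphabet `{0, …, q - 1}`. -/
abbrev Word (q n : ℕ) : Type := Fin n → Fin q

/-- The read coverage of a code: the largest size of the intersection of the error-balls of two
distinct codewords (it is `0` for a code with at most one codeword). -/
def readCoverage {X Y : Type*} [DecidableEq X] [DecidableEq Y]
    (C : Finset X) (B : X → Finset Y) : ℕ :=
  C.offDiag.sup fun p => (B p.1 ∩ B p.2).card

/-- An `(n, N; B)`-reconstruction code: a code whose read coverage is less than `N`. -/
def IsReconstructionCode {q n : ℕ} {Y : Type*} [DecidableEq Y]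
    (N : ℕ) (B : Word q n → Finset Y) (C : Finset (Word q n)) : Prop :=
  readCoverage C B < N

/-- The redundancies `n - log_q |C|` of the nonempty `(n, N; B)`-reconstruction codes `C`. -/
def redundancySet {q n : ℕ} {Y : Type*} [DecidableEq Y]
    (N : ℕ) (B : Word q n → Finset Y) : Set ℝ :=
  {r | ∃ C : Finset (Word q n), C.Nonempty ∧ IsReconstructionCode N B C ∧
    r = (n : ℝ) - Real.logb (q : ℝ) (C.card : ℝ)}

/-- The optimal redundancy `ρ(n, N; B)`. -/
noncomputable def optimalRedundancy {q n : ℕ} {Y : Type*} [DecidableEq Y]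
    (N : ℕ) (B : Word q n → Finset Y) : ℝ :=
  sInf (redundancySet N B)

/-- For a nonempty alphabet and `N ≥ 1` the infimum in `optimalRedundancy` is a minimum. -/
theorem optimalRedundancy_isLeast {q n : ℕ} {Y : Type*} [DecidableEq Y] (hq : 1 ≤ q)
    {N : ℕ} (hN : 1 ≤ N) (B : Word q n → Finset Y) :
    IsLeast (redundancySet N B) (optimalRedundancy N B) := by
  have hfin : (redundancySet N B).Finite := by
    refine (Set.finite_range fun C : Finset (Word q n) =>
      (n : ℝ) - Real.logb (q : ℝ) (C.card : ℝ)).subset ?_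
    rintro r ⟨C, -, -, rfl⟩
    exact ⟨C, rfl⟩
  have hne : (redundancySet N B).Nonempty := by
    refine ⟨_, {fun _ => ⟨0, hq⟩}, Finset.singleton_nonempty _, ?_, rfl⟩
    simp [IsReconstructionCode, readCoverage]
    omega
  exact ⟨hne.csInf_mem hfin, fun r hr => csInf_le hfin.bddBelow hr⟩

/-- The words obtained from `x` by at most one substitution. -/
def substitutionBall {q n : ℕ} (x : Word q n) : Finset (List (Fin q)) :=
  insert (List.ofFn x)
    (Finset.univ.image fun p : Fin n × Fin q => List.ofFn (Function.update x p.1 p.2))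

/-- The words obtained from `x` by exactly one deletion. -/
def deletionBall {q n : ℕ} (x : Word q n) : Finset (List (Fin q)) :=
  Finset.univ.image fun i : Fin n => (List.ofFn x).eraseIdx i

/-- The single-substitution-or-deletion error-ball. -/
def sdBall {q n : ℕ} (x : Word q n) : Finset (List (Fin q)) :=
  substitutionBall x ∪ deletionBall x

/-- `ρ(n, N; B)` for the single-substitution-or-deletion ball over an alphabet of size `q`. -/
noncomputable def rhoSD (q n N : ℕ) : ℝ :=
  optimalRedundancy N (sdBall (q := q) (n := n))

/-- `g(n) = f(n) + Θ(1)`: for some `ε(n) = Θ(1)`, one has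
`f(n) - ε(n) ≤ g(n) ≤ f(n) + ε(n)` for all sufficiently large `n`. -/
def EqAddThetaOne (g f : ℕ → ℝ) : Prop :=
  ∃ ε : ℕ → ℝ, ε =Θ[atTop] (fun _ => (1 : ℝ)) ∧
    ∀ᶠ n in atTop, f n - ε n ≤ g n ∧ g n ≤ f n + ε n

/-! Substitutions keep the length and deletions lower it, so common substitutions and common
deletions of two distinct words are counted separately (`card_sdBall_inter_le`). There are at most
two common deletions (`isDel_common`). There are q common substitutions at Hamming distance 1, two
at distance 2 and none beyond. The balls therefore meet in q + 1 words at distance 1. At distance 2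
they meet in 2 words plus the common deletions: one of these forces a run between the two positions,
and two of them force an adjacent transposition. At larger distance at most 2 words remain. Each N
thus dictates which configurations a code must avoid (`card_sdBall_inter_lt`).

Upper bounds come from pigeonhole (`rhoSD_le_logb`): fix the letter sum and the first moment modulo
suitable numbers and keep the largest class. The sum modulo q excludes distance 1; the moment modulo
q excludes adjacent transpositions. For N = 3, exchanging the ends of a run changes the moment by a
bounded multiple of the run length. At least half of all words are rich, meaning that every window
of some length t = O(log n) contains all letters; their runs are shorter than t, so modulus q * t
suffices. For N ≤ 2 every configuration must go. In the binary case the Levenshtein congruence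
modulo 2n + 1 does this. For general q, letters get the weights (2t) ^ a, so that a block of a rich
word whose mean weight is that of b must be constantly b; this costs a further O(log log n).

Lower bounds come from cliques: sets K of blocks of equal length such that exchanging one block for
another inside a word leaves at least N common words. A code then has few words meeting K in an
aligned block, and words avoiding K are rare (`card_mul_card_le_of_clique`). The cliques are all
single letters, {01, 10}, and the words with a single 1 among 0s. For N ≤ 2 a sphere-packing count
of substitutions is used instead. -/

/-! ### Substitutions and deletions in lists -/

/-- `z` arises from `x` by rewriting the letter at one position. -/
def IsSubst {α : Type*} (x z : List α) : Prop := ∃ u a b v, x = u ++ a :: v ∧ z = u ++ b :: v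

/-- `z` arises from `x` by deleting one letter. -/
def IsDel {α : Type*} (x z : List α) : Prop := ∃ u a v, x = u ++ a :: v ∧ z = u ++ v

theorem IsSubst.length_eq {α : Type*} {x z : List α} (h : IsSubst x z) : z.length = x.length := by
  obtain ⟨u, a, b, v, rfl, rfl⟩ := h
  simp

theorem IsDel.length_eq {α : Type*} {x z : List α} (h : IsDel x z) :
    z.length + 1 = x.length := by
  obtain ⟨u, a, v, rfl, rfl⟩ := h
  simp; omega

theorem isSubst_cons {α : Type*} {c : α} {x z : List α} :
    IsSubst (c :: x) z ↔ (∃ d, z = d :: x) ∨ ∃ z', z = c :: z' ∧ IsSubst x z' := by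
  constructor
  · rintro ⟨u, a, b, v, h, rfl⟩
    cases u with
    | nil => left; simp at h; exact ⟨b, by simp [h]⟩
    | cons d u =>
      simp at h
      exact Or.inr ⟨u ++ b :: v, by simp [h], u, a, b, v, h.2, rfl⟩
  · rintro (⟨d, rfl⟩ | ⟨z', rfl, u, a, b, v, rfl, rfl⟩)
    · exact ⟨[], c, d, x, rfl, rfl⟩
    · exact ⟨c :: u, a, b, v, rfl, rfl⟩

theorem isDel_cons {α : Type*} {c : α} {x z : List α} :
    IsDel (c :: x) z ↔ z = x ∨ ∃ z', z = c :: z' ∧ IsDel x z' := by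
  constructor
  · rintro ⟨u, a, v, h, rfl⟩
    cases u with
    | nil => left; simp at h; simp [h]
    | cons d u =>
      simp at h
      exact Or.inr ⟨u ++ v, by simp [h], u, a, v, h.2, rfl⟩
  · rintro (rfl | ⟨z', rfl, u, a, v, rfl, rfl⟩)
    · exact ⟨[], c, z, rfl, rfl⟩
    · exact ⟨c :: u, a, v, rfl, rfl⟩

/-- If one word spent its substitution inside the common prefix, the other would need its own to
repair the difference of the tails, so the prefix must survive. -/
theorem isSubst_prefix {α : Type*} (u : List α) {x y z : List α} (hxy : x ≠ y)
    (hx : IsSubst (u ++ x) z) (hy : IsSubst (u ++ y) z) :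
    ∃ z', z = u ++ z' ∧ IsSubst x z' ∧ IsSubst y z' := by
  induction u generalizing z with
  | nil => exact ⟨z, rfl, hx, hy⟩
  | cons c u ih =>
    have key : ∀ {p r : List α}, IsSubst (c :: (u ++ p)) z → IsSubst (c :: (u ++ r)) z → p ≠ r →
        ∃ z', z = c :: z' ∧ IsSubst (u ++ p) z' := by
      intro p r hp hr hpr
      rcases isSubst_cons.1 hp with ⟨d, rfl⟩ | h
      · rcases isSubst_cons.1 hr with ⟨e, h⟩ | ⟨z', h, h'⟩
        · simp [hpr] at h
        · simp only [List.cons.injEq] at h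
          obtain ⟨rfl, rfl⟩ := h
          refine ⟨_, rfl, ?_⟩
          -- Only nonemptiness of the tail is taken from `h'`: rewriting a letter by itself counts
          -- as a substitution.
          obtain ⟨s, a, b, v, -, hz⟩ := h'
          exact ⟨s, b, b, v, hz, hz⟩
      · exact h
    obtain ⟨z', rfl, h1⟩ := key hx hy hxy
    obtain ⟨z'', h, h2⟩ := key hy hx hxy.symm
    simp only [List.cons.injEq, true_and] at h
    subst h
    obtain ⟨t, rfl, h⟩ := ih h1 h2
    exact ⟨t, rfl, h⟩

theorem isDel_prefix {α : Type*} (u : List α) {x z : List α} (h : IsDel (u ++ x) (u ++ z)) :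
    IsDel x z := by
  induction u with
  | nil => exact h
  | cons c u ih =>
    apply ih
    rcases isDel_cons.1 h with h | ⟨z', h, h'⟩
    · exact ⟨[], c, u ++ z, h.symm, rfl⟩
    · obtain rfl : u ++ z = z' := by simpa using h
      exact h'

/-- A common deletion of two words arises by deleting their first difference from one of them. -/
theorem isDel_common {α : Type*} {u x y z : List α} {a b : α} (hab : a ≠ b)
    (hx : IsDel (u ++ a :: x) z) (hy : IsDel (u ++ b :: y) z) : z = u ++ x ∨ z = u ++ y := by
  induction u generalizing z with
  | nil =>
    rcases isDel_cons.1 hx with h | ⟨z', rfl, -⟩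
    · exact Or.inl h
    · rcases isDel_cons.1 hy with h | ⟨z'', h, -⟩
      · exact Or.inr h
      · simp [hab] at h
  | cons c u ih =>
    have key : ∀ {p r : List α}, IsDel (c :: p) z → IsDel (c :: r) z → p ≠ r →
        ∃ z', z = c :: z' ∧ IsDel p z' := by
      intro p r hp hr hpr
      rcases isDel_cons.1 hp with rfl | h
      · rcases isDel_cons.1 hr with h | ⟨z', rfl, -⟩
        · exact absurd h hpr
        · exact ⟨_, rfl, [], c, z', rfl, rfl⟩
      · exact h
    have hne : u ++ a :: x ≠ u ++ b :: y := by simp [hab]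
    obtain ⟨z', rfl, h1⟩ := key hx hy hne
    obtain ⟨z'', h, h2⟩ := key hy hx hne.symm
    simp only [List.cons.injEq, true_and] at h
    subst h
    rcases ih h1 h2 with rfl | rfl <;> simp

theorem isSubst_common_one {α : Type*} {u v z : List α} {a b : α} (hab : a ≠ b)
    (hx : IsSubst (u ++ a :: v) z) (hy : IsSubst (u ++ b :: v) z) : ∃ c, z = u ++ c :: v := by
  obtain ⟨z, rfl, h1, h2⟩ := isSubst_prefix u (by simp [hab]) hx hy
  rcases isSubst_cons.1 h1 with ⟨c, rfl⟩ | ⟨z', rfl, -⟩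
  · exact ⟨c, rfl⟩
  · rcases isSubst_cons.1 h2 with ⟨c, h⟩ | ⟨z'', h, -⟩
    · exact ⟨c, by rw [h]⟩
    · simp [hab] at h

theorem isSubst_common_two {α : Type*} {u v w z : List α} {a a' b b' : α} (ha : a ≠ a')
    (hb : b ≠ b') (hx : IsSubst (u ++ a :: (w ++ b :: v)) z)
    (hy : IsSubst (u ++ a' :: (w ++ b' :: v)) z) :
    z = u ++ a' :: (w ++ b :: v) ∨ z = u ++ a :: (w ++ b' :: v) := by
  obtain ⟨z, rfl, h1, h2⟩ := isSubst_prefix u (by simp [ha]) hx hy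
  rcases isSubst_cons.1 h1 with ⟨c, rfl⟩ | ⟨z', rfl, -⟩
  · rcases isSubst_cons.1 h2 with ⟨d, h⟩ | ⟨z'', h, -⟩
    · simp [hb] at h
    · simp only [List.cons.injEq] at h
      simp [h.1]
  · rcases isSubst_cons.1 h2 with ⟨c, h⟩ | ⟨z'', h, -⟩
    · simp only [List.cons.injEq] at h
      simp [h]
    · simp [ha] at h

/-- Distinct words with a common substitution differ in one or two positions. -/
theorem exists_of_isSubst_common {α : Type*} {x y z : List α} (hxy : x ≠ y) (hx : IsSubst x z)
    (hy : IsSubst y z) :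
    (∃ u a b v, a ≠ b ∧ x = u ++ a :: v ∧ y = u ++ b :: v) ∨
    ∃ u a a' w b b' v, a ≠ a' ∧ b ≠ b' ∧ x = u ++ a :: (w ++ b :: v) ∧
      y = u ++ a' :: (w ++ b' :: v) := by
  obtain ⟨u₁, a, c, v₁, rfl, rfl⟩ := hx
  obtain ⟨u₂, b, d, v₂, rfl, h⟩ := hy
  have key : ∀ {u₁ u₂ v₁ v₂ : List α} {a b c d : α}, (∃ s, u₂ = u₁ ++ s ∧ c :: v₁ = s ++ d :: v₂) →
      u₁ ++ a :: v₁ ≠ u₂ ++ b :: v₂ →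
      (∃ u e f v, e ≠ f ∧ u₁ ++ a :: v₁ = u ++ e :: v ∧ u₂ ++ b :: v₂ = u ++ f :: v) ∨
      ∃ u e e' w f f' v, e ≠ e' ∧ f ≠ f' ∧ u₁ ++ a :: v₁ = u ++ e :: (w ++ f :: v) ∧
      u₂ ++ b :: v₂ = u ++ e' :: (w ++ f' :: v) := by
    rintro u₁ u₂ v₁ v₂ a b c d ⟨s, rfl, hs⟩ hne
    cases s with
    | nil =>
      simp only [List.nil_append, List.cons.injEq] at hs
      obtain ⟨rfl, rfl⟩ := hs
      left
      refine ⟨u₁, a, b, v₁, ?_, rfl, by simp⟩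
      rintro rfl; simp at hne
    | cons c' s =>
      simp only [List.cons_append, List.cons.injEq] at hs
      obtain ⟨rfl, rfl⟩ := hs
      by_cases hac : a = c
      · subst hac
        left
        refine ⟨u₁ ++ a :: s, d, b, v₂, ?_, by simp, by simp⟩
        rintro rfl; simp at hne
      · by_cases hbd : d = b
        · subst hbd
          left
          exact ⟨u₁, a, c, s ++ d :: v₂, hac, by simp, by simp⟩
        · right
          exact ⟨u₁, a, c, s, d, b, v₂, hac, hbd, by simp, by simp⟩
  rcases List.append_eq_append_iff.1 h with ⟨s, h1, h2⟩ | ⟨s, h1, h2⟩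
  · exact key ⟨s, h1, h2⟩ hxy
  · rcases key (a := b) (b := a) ⟨s, h1, h2⟩ hxy.symm with
      ⟨u, e, f, v, h, h1, h2⟩ | ⟨u, e, e', w, f, f', v, h, h', h1, h2⟩
    · exact Or.inl ⟨u, f, e, v, h.symm, h2, h1⟩
    · exact Or.inr ⟨u, e', e, w, f', f, v, h.symm, h'.symm, h2, h1⟩

/-- Words with a common deletion arise from each other by moving and rewriting one letter. -/
theorem exists_of_isDel_common {α : Type*} {x y z : List α} (hx : IsDel x z) (hy : IsDel y z) :
    ∃ u a w b v, (x = u ++ a :: (w ++ v) ∧ y = u ++ (w ++ b :: v)) ∨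
      (y = u ++ a :: (w ++ v) ∧ x = u ++ (w ++ b :: v)) := by
  obtain ⟨u₁, a, v₁, rfl, rfl⟩ := hx
  obtain ⟨u₂, b, v₂, rfl, h⟩ := hy
  rcases List.append_eq_append_iff.1 h with ⟨s, rfl, rfl⟩ | ⟨s, rfl, rfl⟩
  · exact ⟨u₁, a, s, b, v₂, Or.inl ⟨rfl, by simp⟩⟩
  · exact ⟨u₂, b, s, a, v₁, Or.inr ⟨rfl, by simp⟩⟩

/-- Deleting a letter before `b'` would put `b'` where the result has `b`. So the prefix `a :: w`
survives and must agree with `w ++ [b]`. -/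
theorem append_singleton_eq_cons_of_isDel {α : Type*} {a b b' : α} {w v : List α} (hb : b ≠ b')
    (h : IsDel (a :: (w ++ b' :: v)) (w ++ b :: v)) : w ++ [b] = a :: w := by
  induction w generalizing a with
  | nil =>
    rcases isDel_cons.1 h with h | ⟨z, h, -⟩
    · simp [hb] at h
    · simp at h; simp [h]
  | cons c w ih =>
    rcases isDel_cons.1 h with h | ⟨z, h, h'⟩
    · simp [hb] at h
    · simp only [List.cons_append, List.cons.injEq] at h
      obtain ⟨rfl, rfl⟩ := h
      simpa using ih h'

theorem eq_replicate_of_append_singleton_eq_cons {α : Type*} {a b : α} {w : List α}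
    (h : w ++ [b] = a :: w) : b = a ∧ w = List.replicate w.length a := by
  induction w with
  | nil => simpa using h
  | cons c w ih =>
    simp only [List.cons_append, List.cons.injEq] at h
    obtain ⟨rfl, h⟩ := h
    obtain ⟨h1, h2⟩ := ih h
    exact ⟨h1, by rw [List.length_cons, List.replicate_succ, ← h2]⟩

theorem isDel_two {α : Type*} {u v w z : List α} {a a' b b' : α} (ha : a ≠ a')
    (hb : b ≠ b') (hx : IsDel (u ++ a :: (w ++ b :: v)) z)
    (hy : IsDel (u ++ a' :: (w ++ b' :: v)) z) :
    (z = u ++ (w ++ b :: v) ∧ w ++ [b] = a' :: w) ∨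
    (z = u ++ (w ++ b' :: v) ∧ w ++ [b'] = a :: w) := by
  rcases isDel_common ha hx hy with rfl | rfl
  · exact Or.inl ⟨rfl, append_singleton_eq_cons_of_isDel hb (isDel_prefix u hy)⟩
  · exact Or.inr ⟨rfl, append_singleton_eq_cons_of_isDel hb.symm (isDel_prefix u hx)⟩

/-! ### Moments -/

/-- The first moment `∑ i, i * φ (x i)` of a word, with positions numbered from `1`. -/
def moment {α : Type*} (φ : α → ℤ) : List α → ℤ
  | [] => 0
  | a :: x => φ a + ((x.map φ).sum + moment φ x)

theorem moment_append {α : Type*} (φ : α → ℤ) (u v : List α) :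
    moment φ (u ++ v) = moment φ u + u.length * (v.map φ).sum + moment φ v := by
  induction u with
  | nil => simp [moment]
  | cons a u ih =>
    simp only [List.cons_append, moment, ih, List.map_append, List.sum_append, List.length_cons]
    push_cast; ring

theorem sum_sub_sum_shift {α : Type*} (φ : α → ℤ) (u w v : List α) (a b : α) :
    ((u ++ a :: (w ++ v)).map φ).sum - ((u ++ (w ++ b :: v)).map φ).sum = φ a - φ b := by
  simp; ring

/-- This is the shape of two words with a common deletion: the block `w` moves by one position and
so contributes its sum. With `w = []` it also covers a single substitution. -/
theorem moment_sub_moment_shift {α : Type*} (φ : α → ℤ) (u w v : List α) (a b : α) :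
    moment φ (u ++ a :: (w ++ v)) - moment φ (u ++ (w ++ b :: v)) =
      (u.length + 1) * (φ a - φ b) + (w.map φ).sum - w.length * φ b := by
  simp [moment_append, moment]; ring

theorem sum_sub_sum_two {α : Type*} (φ : α → ℤ) (u w v : List α) (a a' b b' : α) :
    ((u ++ a :: (w ++ b :: v)).map φ).sum - ((u ++ a' :: (w ++ b' :: v)).map φ).sum =
      (φ a - φ a') + (φ b - φ b') := by
  simp; ring

theorem moment_sub_moment_two {α : Type*} (φ : α → ℤ) (u w v : List α) (a a' b b' : α) :
    moment φ (u ++ a :: (w ++ b :: v)) - moment φ (u ++ a' :: (w ++ b' :: v)) =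
      (u.length + 1) * (φ a - φ a') + (u.length + w.length + 2) * (φ b - φ b') := by
  simp [moment_append, moment]; ring

/-! ### Intersections of error-balls -/

theorem mem_deletionBall {q n : ℕ} {x : Word q n} {z : List (Fin q)} :
    z ∈ deletionBall x ↔ IsDel (List.ofFn x) z := by
  simp only [deletionBall, Finset.mem_image, Finset.mem_univ, true_and]
  constructor
  · rintro ⟨i, rfl⟩
    have hi : (i : ℕ) < (List.ofFn x).length := by simp
    refine ⟨(List.ofFn x).take i, (List.ofFn x)[(i : ℕ)], (List.ofFn x).drop (i + 1), ?_, ?_⟩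
    · rw [← List.drop_eq_getElem_cons, List.take_append_drop]
    · rw [List.eraseIdx_eq_take_drop_succ]
  · rintro ⟨u, a, v, h, rfl⟩
    have hl := congrArg List.length h
    simp at hl
    refine ⟨⟨u.length, by omega⟩, ?_⟩
    simp [h, List.eraseIdx_append_of_length_le]

theorem ofFn_update {α : Type*} {n : ℕ} (x : Fin n → α) (i : Fin n) (a : α) :
    List.ofFn (Function.update x i a) = (List.ofFn x).set i a := by
  apply List.ext_getElem
  · simp
  · intro j h1 h2
    simp only [List.getElem_ofFn, List.getElem_set, Function.update_apply, Fin.ext_iff]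
    simp [eq_comm]

theorem isSubst_ofFn_update {α : Type*} {n : ℕ} (x : Fin n → α) (i : Fin n) (a : α) :
    IsSubst (List.ofFn x) (List.ofFn (Function.update x i a)) := by
  have hi : (i : ℕ) < (List.ofFn x).length := by simp
  refine ⟨(List.ofFn x).take i, (List.ofFn x)[(i : ℕ)], a, (List.ofFn x).drop (i + 1), ?_, ?_⟩
  · rw [← List.drop_eq_getElem_cons, List.take_append_drop]
  · rw [ofFn_update, List.set_eq_take_append_cons_drop, if_pos hi]

theorem mem_substitutionBall {q n : ℕ} (hn : 0 < n) {x : Word q n} {z : List (Fin q)} :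
    z ∈ substitutionBall x ↔ IsSubst (List.ofFn x) z := by
  simp only [substitutionBall, Finset.mem_insert, Finset.mem_image, Finset.mem_univ, true_and]
  constructor
  · rintro (rfl | ⟨⟨i, a⟩, rfl⟩)
    · simpa using isSubst_ofFn_update x ⟨0, hn⟩ (x ⟨0, hn⟩)
    · exact isSubst_ofFn_update x i a
  · rintro ⟨u, a, b, v, h, rfl⟩
    have hl := congrArg List.length h
    simp at hl
    refine Or.inr ⟨(⟨u.length, by omega⟩, b), ?_⟩
    simp [ofFn_update, h]

theorem mem_sdBall {q n : ℕ} (hn : 0 < n) {x : Word q n} {z : List (Fin q)} :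
    z ∈ sdBall x ↔ IsSubst (List.ofFn x) z ∨ IsDel (List.ofFn x) z := by
  rw [sdBall, Finset.mem_union, mem_substitutionBall hn, mem_deletionBall]

theorem pos_of_word_ne {q n : ℕ} {x y : Word q n} (h : x ≠ y) : 0 < n := by
  rcases Nat.eq_zero_or_pos n with rfl | hn
  · exact absurd (Subsingleton.elim x y) h
  · exact hn

theorem card_sdBall_inter_le {q n : ℕ} {x y : Word q n} (hxy : x ≠ y) :
    (sdBall x ∩ sdBall y).card ≤
      (substitutionBall x ∩ substitutionBall y).card + (deletionBall x ∩ deletionBall y).card := by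
  have hn := pos_of_word_ne hxy
  refine le_trans (Finset.card_le_card fun z hz => ?_) (Finset.card_union_le _ _)
  simp only [Finset.mem_inter, Finset.mem_union, mem_sdBall hn, mem_substitutionBall hn,
    mem_deletionBall] at hz ⊢
  rcases hz with ⟨h1 | h1, h2 | h2⟩
  · exact Or.inl ⟨h1, h2⟩
  · have := h1.length_eq; have := h2.length_eq; simp at *; omega
  · have := h1.length_eq; have := h2.length_eq; simp at *; omega
  · exact Or.inr ⟨h1, h2⟩

theorem exists_first_difference {α : Type*} {x y : List α} (hl : x.length = y.length)
    (hxy : x ≠ y) : ∃ u a b x' y', a ≠ b ∧ x = u ++ a :: x' ∧ y = u ++ b :: y' := by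
  induction x generalizing y with
  | nil => cases y <;> simp at *
  | cons c x ih =>
    cases y with
    | nil => simp at hl
    | cons d y =>
      by_cases h : c = d
      · subst h
        obtain ⟨u, a, b, x', y', hab, rfl, rfl⟩ := ih (by simpa using hl) (by simpa using hxy)
        exact ⟨c :: u, a, b, x', y', hab, rfl, rfl⟩
      · exact ⟨[], c, d, x, y, h, rfl, rfl⟩

theorem card_deletionBall_inter_le_two {q n : ℕ} {x y : Word q n} (hxy : x ≠ y) :
    (deletionBall x ∩ deletionBall y).card ≤ 2 := by
  obtain ⟨u, a, b, x', y', hab, hx, hy⟩ := exists_first_difference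
    (x := List.ofFn x) (y := List.ofFn y) (by simp) (List.ofFn_injective.ne hxy)
  refine le_trans (Finset.card_le_card (t := {u ++ x', u ++ y'}) fun z hz => ?_) Finset.card_le_two
  simp only [Finset.mem_inter, mem_deletionBall, hx, hy] at hz
  simpa using isDel_common hab hz.1 hz.2

/-- The hypotheses follow the Hamming distance: 1, 2, or too large for a common substitution. Each
can be met either by arithmetic, when `N` is large, or by a contradiction, when the code excludes
the configuration. -/
theorem card_sdBall_inter_lt {q n N : ℕ} {x y : Word q n} (hxy : x ≠ y)
    (h₁ : ∀ u a b v, a ≠ b → List.ofFn x = u ++ a :: v → List.ofFn y = u ++ b :: v → q + 1 < N)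
    (h₂ : ∀ u a a' w b b' v, a ≠ a' → b ≠ b' → List.ofFn x = u ++ a :: (w ++ b :: v) →
      List.ofFn y = u ++ a' :: (w ++ b' :: v) →
      2 + (deletionBall x ∩ deletionBall y).card < N)
    (h₃ : (deletionBall x ∩ deletionBall y).card < N) :
    (sdBall x ∩ sdBall y).card < N := by
  have hn := pos_of_word_ne hxy
  have hle := card_sdBall_inter_le hxy
  rcases Finset.eq_empty_or_nonempty (substitutionBall x ∩ substitutionBall y) with h0 | ⟨z, hz⟩
  · simp only [h0, Finset.card_empty] at hle
    omega
  · simp only [Finset.mem_inter, mem_substitutionBall hn] at hz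
    rcases exists_of_isSubst_common (List.ofFn_injective.ne hxy) hz.1 hz.2 with
      ⟨u, a, b, v, hab, hx, hy⟩ | ⟨u, a, a', w, b, b', v, ha, hb, hx, hy⟩
    · have hs : (substitutionBall x ∩ substitutionBall y).card ≤ q := by
        refine le_trans (Finset.card_le_card
          (t := Finset.univ.image fun c => u ++ c :: v) fun z hz => ?_)
          (Finset.card_image_le.trans (by simp))
        simp only [Finset.mem_inter, mem_substitutionBall hn, hx, hy] at hz
        obtain ⟨c, rfl⟩ := isSubst_common_one hab hz.1 hz.2
        simp
      have hd : (deletionBall x ∩ deletionBall y).card ≤ 1 := by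
        refine le_trans (Finset.card_le_card (t := {u ++ v}) fun z hz => ?_)
          (Finset.card_singleton _).le
        simp only [Finset.mem_inter, mem_deletionBall, hx, hy] at hz
        simpa using isDel_common hab hz.1 hz.2
      have := h₁ u a b v hab hx hy
      omega
    · have hs : (substitutionBall x ∩ substitutionBall y).card ≤ 2 := by
        refine le_trans (Finset.card_le_card
          (t := {u ++ a' :: (w ++ b :: v), u ++ a :: (w ++ b' :: v)}) fun z hz => ?_)
          Finset.card_le_two
        simp only [Finset.mem_inter, mem_substitutionBall hn, hx, hy] at hz
        simpa using isSubst_common_two ha hb hz.1 hz.2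
      have := h₂ u a a' w b b' v ha hb hx hy
      omega

/-- Words at Hamming distance two with two common deletions differ by an adjacent
transposition. -/
theorem adjacent_transposition_of_two_le_card {q n : ℕ} {x y : Word q n}
    {u w v : List (Fin q)} {a a' b b' : Fin q} (ha : a ≠ a') (hb : b ≠ b')
    (hx : List.ofFn x = u ++ a :: (w ++ b :: v)) (hy : List.ofFn y = u ++ a' :: (w ++ b' :: v))
    (h : 2 ≤ (deletionBall x ∩ deletionBall y).card) : w = [] ∧ b = a' ∧ b' = a := by
  obtain ⟨z₁, h1, z₂, h2, hne⟩ := Finset.one_lt_card.1 h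
  simp only [Finset.mem_inter, mem_deletionBall, hx, hy] at h1 h2
  -- Two different common deletions realise both alternatives of `isDel_two`. If `w` were nonempty,
  -- its first letter would equal both `a` and `a'`.
  have key : w ++ [b] = a' :: w ∧ w ++ [b'] = a :: w := by
    rcases isDel_two ha hb h1.1 h1.2 with ⟨e1, f1⟩ | ⟨e1, f1⟩ <;>
    rcases isDel_two ha hb h2.1 h2.2 with ⟨e2, f2⟩ | ⟨e2, f2⟩
    · exact absurd (e1.trans e2.symm) hne
    · exact ⟨f1, f2⟩
    · exact ⟨f2, f1⟩
    · exact absurd (e1.trans e2.symm) hne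
  cases w with
  | nil => simpa using key
  | cons c w =>
    simp only [List.cons_append, List.cons.injEq] at key
    exact absurd (key.2.1.symm.trans key.1.1) ha

/-- Words at Hamming distance two with a common deletion. -/
theorem exists_replicate_of_isDel_common {α : Type*} {u w v z : List α} {a a' b b' : α}
    (ha : a ≠ a') (hb : b ≠ b') (hx : IsDel (u ++ a :: (w ++ b :: v)) z)
    (hy : IsDel (u ++ a' :: (w ++ b' :: v)) z) :
    ∃ c, (c = a' ∧ c = b ∨ c = a ∧ c = b') ∧ w = List.replicate w.length c := by
  rcases isDel_two ha hb hx hy with ⟨-, h⟩ | ⟨-, h⟩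
  · obtain ⟨h1, h2⟩ := eq_replicate_of_append_singleton_eq_cons h
    exact ⟨a', Or.inl ⟨rfl, h1.symm⟩, h2⟩
  · obtain ⟨h1, h2⟩ := eq_replicate_of_append_singleton_eq_cons h
    exact ⟨a, Or.inr ⟨rfl, h1.symm⟩, h2⟩

theorem le_card_sdBall_inter_of_one {q n : ℕ} {x y : Word q n} {u v : List (Fin q)}
    {a b : Fin q} (hx : List.ofFn x = u ++ a :: v) (hy : List.ofFn y = u ++ b :: v) :
    q + 1 ≤ (sdBall x ∩ sdBall y).card := by
  have hn : 0 < n := by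
    have hl := congrArg List.length hx
    simp at hl; omega
  have hinj : Function.Injective fun c : Fin q => u ++ c :: v := fun c d h => by simpa using h
  have hcard : (insert (u ++ v) (Finset.univ.image fun c : Fin q => u ++ c :: v)).card = q + 1 := by
    rw [Finset.card_insert_of_notMem, Finset.card_image_of_injective _ hinj, Finset.card_univ,
      Fintype.card_fin]
    simp
  rw [← hcard]
  refine Finset.card_le_card fun z hz => ?_
  simp only [Finset.mem_insert, Finset.mem_image, Finset.mem_univ, true_and] at hz
  simp only [Finset.mem_inter, mem_sdBall hn, hx, hy]
  rcases hz with rfl | ⟨c, rfl⟩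
  · exact ⟨Or.inr ⟨u, a, v, rfl, rfl⟩, Or.inr ⟨u, b, v, rfl, rfl⟩⟩
  · exact ⟨Or.inl ⟨u, a, c, v, rfl, rfl⟩, Or.inl ⟨u, b, c, v, rfl, rfl⟩⟩

theorem le_card_sdBall_inter_of_two {q n : ℕ} {x y : Word q n} {u w v : List (Fin q)}
    {a a' b b' : Fin q} (ha : a ≠ a') (hx : List.ofFn x = u ++ a :: (w ++ b :: v))
    (hy : List.ofFn y = u ++ a' :: (w ++ b' :: v)) :
    2 ≤ (sdBall x ∩ sdBall y).card := by
  have hn : 0 < n := by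
    have hl := congrArg List.length hx
    simp at hl; omega
  have hne : u ++ a' :: (w ++ b :: v) ≠ u ++ a :: (w ++ b' :: v) := by simp [ha.symm]
  rw [← Finset.card_pair hne]
  refine Finset.card_le_card fun z hz => ?_
  simp only [Finset.mem_insert, Finset.mem_singleton] at hz
  simp only [Finset.mem_inter, mem_sdBall hn, hx, hy]
  rcases hz with rfl | rfl
  · exact ⟨Or.inl ⟨u, a, a', _, rfl, rfl⟩,
      Or.inl ⟨u ++ a' :: w, b', b, v, by simp, by simp⟩⟩
  · exact ⟨Or.inl ⟨u ++ a :: w, b, b', v, by simp, by simp⟩, Or.inl ⟨u, a', a, _, rfl, rfl⟩⟩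

/-- Besides the two common substitutions, deleting `a` from either word leaves the same run of `b`.
-/
theorem le_card_sdBall_inter_of_shift {q n : ℕ} {x y : Word q n} {u v : List (Fin q)}
    {a b : Fin q} (s : ℕ) (hab : a ≠ b)
    (hx : List.ofFn x = u ++ a :: (List.replicate s b ++ b :: v))
    (hy : List.ofFn y = u ++ b :: (List.replicate s b ++ a :: v)) :
    3 ≤ (sdBall x ∩ sdBall y).card := by
  have hn : 0 < n := by
    have hl := congrArg List.length hx
    simp at hl; omega
  have hcard : ({u ++ b :: (List.replicate s b ++ b :: v), u ++ a :: (List.replicate s b ++ a :: v),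
      u ++ (List.replicate s b ++ b :: v)} : Finset (List (Fin q))).card = 3 := by
    rw [Finset.card_eq_three]
    refine ⟨_, _, _, ?_, ?_, ?_, rfl⟩
    · simp [hab.symm]
    · intro h; simpa using congrArg List.length h
    · intro h; simpa using congrArg List.length h
  rw [← hcard]
  refine Finset.card_le_card fun z hz => ?_
  simp only [Finset.mem_insert, Finset.mem_singleton] at hz
  simp only [Finset.mem_inter, mem_sdBall hn, hx, hy]
  have hrep : List.replicate s b ++ b :: v = b :: (List.replicate s b ++ v) := by
    rw [← List.cons_append, ← List.replicate_succ, List.replicate_succ']; simp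
  rcases hz with rfl | rfl | rfl
  · exact ⟨Or.inl ⟨u, a, b, _, rfl, rfl⟩,
      Or.inl ⟨u ++ b :: List.replicate s b, a, b, v, by simp, by simp⟩⟩
  · exact ⟨Or.inl ⟨u ++ a :: List.replicate s b, b, a, v, by simp, by simp⟩,
      Or.inl ⟨u, b, a, _, rfl, rfl⟩⟩
  · refine ⟨Or.inr ⟨u, a, _, rfl, rfl⟩,
      Or.inr ⟨u ++ b :: List.replicate s b, a, v, by simp, by simp [hrep]⟩⟩

theorem le_card_sdBall_inter_of_transposition {q n : ℕ} {x y : Word q n} {u v : List (Fin q)}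
    {a b : Fin q} (hab : a ≠ b) (hx : List.ofFn x = u ++ a :: b :: v)
    (hy : List.ofFn y = u ++ b :: a :: v) : 4 ≤ (sdBall x ∩ sdBall y).card := by
  have hn : 0 < n := by
    have hl := congrArg List.length hx
    simp at hl; omega
  have hcard : ({u ++ b :: b :: v, u ++ a :: a :: v, u ++ a :: v, u ++ b :: v} :
      Finset (List (Fin q))).card = 4 := by
    rw [Finset.card_insert_of_notMem, Finset.card_insert_of_notMem, Finset.card_pair]
    · simp [hab]
    · simp
    · simp [hab.symm]
  rw [← hcard]
  refine Finset.card_le_card fun z hz => ?_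
  simp only [Finset.mem_insert, Finset.mem_singleton] at hz
  simp only [Finset.mem_inter, mem_sdBall hn, hx, hy]
  rcases hz with rfl | rfl | rfl | rfl
  · exact ⟨Or.inl ⟨u, a, b, _, rfl, rfl⟩, Or.inl ⟨u ++ [b], a, b, v, by simp, by simp⟩⟩
  · exact ⟨Or.inl ⟨u ++ [a], b, a, v, by simp, by simp⟩, Or.inl ⟨u, b, a, _, rfl, rfl⟩⟩
  · exact ⟨Or.inr ⟨u ++ [a], b, v, by simp, by simp⟩, Or.inr ⟨u, b, _, rfl, rfl⟩⟩
  · exact ⟨Or.inr ⟨u, a, _, rfl, rfl⟩, Or.inr ⟨u ++ [b], a, v, by simp, by simp⟩⟩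

/-! ### Redundancy bounds from code sizes -/

theorem isReconstructionCode_iff {q n : ℕ} {Y : Type*} [DecidableEq Y] {N : ℕ} (hN : 0 < N)
    {B : Word q n → Finset Y} {C : Finset (Word q n)} :
    IsReconstructionCode N B C ↔ ∀ x ∈ C, ∀ y ∈ C, x ≠ y → (B x ∩ B y).card < N := by
  rw [IsReconstructionCode, readCoverage, Finset.sup_lt_iff (by simpa using hN)]
  simp only [Finset.mem_offDiag, Prod.forall]
  exact ⟨fun h x hx y hy hxy => h x y ⟨hx, hy, hxy⟩, fun h x y ⟨hx, hy, hxy⟩ => h x hx y hy hxy⟩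

/-- The largest fibre of `f` on `G` is a code of at least `q ^ n / (k * |T|)` words. Here `1 / k`
bounds the density of `G` from below. -/
theorem rhoSD_le_logb {q n N k : ℕ} {T : Type*} [Fintype T] [DecidableEq T] (hq : 2 ≤ q)
    (hN : 0 < N) (G : Finset (Word q n)) (hG : q ^ n ≤ k * G.card) (f : Word q n → T)
    (h : ∀ x ∈ G, ∀ y ∈ G, f x = f y → x ≠ y → (sdBall x ∩ sdBall y).card < N) :
    rhoSD q n N ≤ Real.logb q ((k * Fintype.card T : ℕ) : ℝ) := by
  have hq0 : 0 < q ^ n := by positivity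
  obtain ⟨x₀, hx₀⟩ : G.Nonempty := by
    rw [Finset.nonempty_iff_ne_empty]; rintro rfl; simp at hG; omega
  obtain ⟨t, -, ht⟩ := Finset.exists_max_image Finset.univ
    (fun t => (G.filter fun x => f x = t).card) ⟨f x₀, Finset.mem_univ _⟩
  set C := G.filter fun x => f x = t with hC
  have hle : G.card ≤ Fintype.card T * C.card := by
    rw [Finset.card_eq_sum_card_fiberwise (f := f) (t := Finset.univ) (by simp)]
    simpa using Finset.sum_le_card_nsmul Finset.univ _ C.card ht
  have hcard : q ^ n ≤ (k * Fintype.card T) * C.card := by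
    rw [mul_assoc]; exact hG.trans (Nat.mul_le_mul_left _ hle)
  have hCpos : 0 < C.card := by
    rcases Nat.eq_zero_or_pos C.card with h0 | h0
    · rw [h0] at hcard; omega
    · exact h0
  have hMpos : 0 < k * Fintype.card T := by
    rcases Nat.eq_zero_or_pos (k * Fintype.card T) with h0 | h0
    · rw [h0] at hcard; omega
    · exact h0
  have hmem : (n : ℝ) - Real.logb q C.card ∈ redundancySet N (sdBall (q := q) (n := n)) := by
    refine ⟨C, Finset.card_pos.1 hCpos, (isReconstructionCode_iff hN).2 ?_, rfl⟩
    intro x hx y hy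
    rw [hC, Finset.mem_filter] at hx hy
    exact h x hx.1 y hy.1 (hx.2.trans hy.2.symm)
  refine ((optimalRedundancy_isLeast (by omega) hN _).2 hmem).trans ?_
  have hq1 : (1 : ℝ) < q := by exact_mod_cast hq
  have hlog : (n : ℝ) ≤ Real.logb q (((k * Fintype.card T) * C.card : ℕ) : ℝ) := by
    have : (n : ℝ) = Real.logb q ((q : ℝ) ^ n) := by
      rw [Real.logb_pow, Real.logb_self_eq_one hq1, mul_one]
    rw [this]
    exact Real.logb_le_logb_of_le hq1 (by positivity) (by exact_mod_cast hcard)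
  rw [Nat.cast_mul, Real.logb_mul (by positivity) (by positivity)] at hlog
  linarith

theorem logb_le_rhoSD {q n N : ℕ} {M : ℝ} (hq : 2 ≤ q) (hN : 0 < N) (hM : 0 < M)
    (h : ∀ C : Finset (Word q n), IsReconstructionCode N sdBall C → M * C.card ≤ (q : ℝ) ^ n) :
    Real.logb q M ≤ rhoSD q n N := by
  obtain ⟨C, hC, hrec, hr⟩ := (optimalRedundancy_isLeast (by omega) hN
    (sdBall (q := q) (n := n))).1
  rw [rhoSD, hr]
  have hq1 : (1 : ℝ) < q := by exact_mod_cast hq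
  have hCpos : (0 : ℝ) < C.card := by exact_mod_cast hC.card_pos
  have hlog := Real.logb_le_logb_of_le hq1 (by positivity) (h C hrec)
  rw [Real.logb_mul hM.ne' hCpos.ne', Real.logb_pow, Real.logb_self_eq_one hq1] at hlog
  linarith

/-! ### Lower bounds on the redundancy -/

/-- The words of length `n` as lists. -/
def wordLists (q n : ℕ) : Finset (List (Fin q)) :=
  Finset.univ.image (List.ofFn : (Fin n → Fin q) → List (Fin q))

theorem mem_wordLists {q n : ℕ} {x : List (Fin q)} : x ∈ wordLists q n ↔ x.length = n := by
  simp only [wordLists, Finset.mem_image, Finset.mem_univ, true_and]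
  constructor
  · rintro ⟨f, rfl⟩; simp
  · rintro rfl; exact ⟨x.get, List.ofFn_get x⟩

theorem card_wordLists (q n : ℕ) : (wordLists q n).card = q ^ n := by
  rw [wordLists, Finset.card_image_of_injective _ List.ofFn_injective]
  simp

/-- A code that contains at most one word of each family `u w v`, `w ∈ K`, is small. -/
theorem card_mul_card_le_of_clique {q L : ℕ} (K : Finset (List (Fin q)))
    (hK : ∀ w ∈ K, w.length = L) (m r : ℕ) (C : Finset (List (Fin q)))
    (hC : ∀ x ∈ C, x.length = m * L + r)
    (hind : ∀ u v, ∀ w ∈ K, ∀ w' ∈ K, u ++ (w ++ v) ∈ C → u ++ (w' ++ v) ∈ C → w = w') :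
    K.card * C.card ≤ q ^ (m * L + r) + K.card * ((q ^ L - K.card) ^ m * q ^ r) := by
  induction m generalizing C with
  | zero =>
    have : C.card ≤ q ^ r := by
      rw [← card_wordLists]
      exact Finset.card_le_card fun x hx => mem_wordLists.2 (by simpa using hC x hx)
    simpa using le_add_left (Nat.mul_le_mul_left _ this)
  | succ m ih =>
    set n' := m * L + r with hn'
    have hlen : ∀ x ∈ C, x.length = L + n' := fun x hx => by rw [hC x hx, hn']; ring
    have hKsub : K ⊆ wordLists q L := fun w hw => mem_wordLists.2 (hK w hw)
    have hKle : K.card ≤ q ^ L := card_wordLists q L ▸ Finset.card_le_card hKsub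
    -- A codeword whose first block lies in `K` is determined by the rest of the word, by the clique
    -- property.
    have hA : (C.filter fun x => x.take L ∈ K).card ≤ q ^ n' := by
      rw [← card_wordLists]
      refine Finset.card_le_card_of_injOn (fun x => x.drop L) ?_ ?_
      · intro x hx
        simp only [Finset.coe_filter, Set.mem_ofPred_eq] at hx
        simp [mem_wordLists, hlen x hx.1]
      · intro x hx y hy hxy
        simp only [Finset.coe_filter, Set.mem_ofPred_eq] at hx hy hxy
        have := hind [] (x.drop L) _ hx.2 _ hy.2
          (by simpa using hx.1) (by rw [hxy]; simpa using hy.1)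
        rw [← List.take_append_drop L x, ← List.take_append_drop L y, this]
        congr 1
    -- Fixing a first block outside `K` leaves tails that satisfy the same hypotheses with one block
    -- fewer.
    have hB : K.card * (C.filter fun x => ¬ x.take L ∈ K).card ≤
        (q ^ L - K.card) * (q ^ n' + K.card * ((q ^ L - K.card) ^ m * q ^ r)) := by
      rw [Finset.card_eq_sum_card_fiberwise (s := C.filter fun x => ¬ x.take L ∈ K) (f := fun x => x.take L) 
        (t := wordLists q L \ K), Finset.mul_sum]
      · have hcard : (wordLists q L \ K).card = q ^ L - K.card := by
          rw [Finset.card_sdiff_of_subset hKsub, card_wordLists]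
        rw [← hcard, ← smul_eq_mul (wordLists q L \ K).card]
        refine Finset.sum_le_card_nsmul _ _ _ fun w hw => ?_
        rw [hcard]
        set F := (C.filter fun x => ¬ x.take L ∈ K).filter fun x => x.take L = w with hF
        have hFmem : ∀ v, v ∈ F.image (fun x => x.drop L) → w ++ v ∈ C := by
          intro v hv
          obtain ⟨x, hx, rfl⟩ := Finset.mem_image.1 hv
          simp only [hF, Finset.mem_filter] at hx
          rw [← hx.2, List.take_append_drop]
          exact hx.1.1
        have hFcard : (F.image fun x => x.drop L).card = F.card := by
          refine Finset.card_image_of_injOn fun x hx y hy hxy => ?_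
          simp only [hF, Finset.coe_filter, Finset.mem_filter, Set.mem_ofPred_eq] at hx hy
          rw [← List.take_append_drop L x, ← List.take_append_drop L y, hx.2, hy.2]
          congr 1
        rw [← hFcard]
        refine ih _ (fun v hv => ?_) fun u v w₁ h₁ w₂ h₂ hm₁ hm₂ => ?_
        · have h1 := hlen _ (hFmem v hv)
          have h2 := mem_wordLists.1 (Finset.mem_sdiff.1 hw).1
          simp at h1; omega
        · exact hind (w ++ u) v w₁ h₁ w₂ h₂ (by simpa using hFmem _ hm₁)
            (by simpa using hFmem _ hm₂)
      · intro x hx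
        simp only [Finset.coe_filter, Set.mem_ofPred_eq] at hx
        simp [mem_wordLists, hlen x hx.1, hx.2]
    have hsplit := Finset.card_filter_add_card_filter_not (s := C) (fun x => x.take L ∈ K)
    have hA' := Nat.mul_le_mul_left K.card hA
    rw [← hsplit, mul_add]
    refine (add_le_add hA' hB).trans (le_of_eq ?_)
    obtain ⟨d, hd⟩ := Nat.exists_eq_add_of_le hKle
    have hpow : q ^ ((m + 1) * L + r) = q ^ L * q ^ n' := by rw [← pow_add, hn']; congr 1; ring
    rw [hpow, hd, Nat.add_sub_cancel_left]
    ring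

theorem card_mul_card_le_of_clique_code {q L n N : ℕ} (hN : 0 < N) (K : Finset (List (Fin q)))
    (hK : ∀ w ∈ K, w.length = L) (m r : ℕ) (hn : n = m * L + r) (C : Finset (Word q n))
    (hC : IsReconstructionCode N sdBall C)
    (hind : ∀ x y : Word q n, ∀ u v, ∀ w ∈ K, ∀ w' ∈ K, w ≠ w' → List.ofFn x = u ++ (w ++ v) →
      List.ofFn y = u ++ (w' ++ v) → N ≤ (sdBall x ∩ sdBall y).card) :
    K.card * C.card ≤ q ^ n + K.card * ((q ^ L - K.card) ^ m * q ^ r) := by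
  rw [← Finset.card_image_of_injective C List.ofFn_injective]
  have := card_mul_card_le_of_clique K hK m r (C.image List.ofFn) (fun z hz => ?_)
    fun u v w hw w' hw' h1 h2 => ?_
  · rwa [← hn] at this
  · obtain ⟨x, -, rfl⟩ := Finset.mem_image.1 hz
    simp [hn]
  · obtain ⟨x, hx, hx'⟩ := Finset.mem_image.1 h1
    obtain ⟨y, hy, hy'⟩ := Finset.mem_image.1 h2
    by_contra hne
    have hxy : x ≠ y := by
      rintro rfl
      rw [hx'] at hy'
      simp [hne] at hy'
    have := (isReconstructionCode_iff hN).1 hC x hx y hy hxy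
    have := hind x y u v w hw w' hw' hne hx' hy'
    omega

theorem one_le_rhoSD {q n N : ℕ} (hq : 2 ≤ q) (hn : 1 ≤ n) (hN : 0 < N) (hNq : N ≤ q + 1) :
    1 ≤ rhoSD q n N := by
  have hq1 : (1 : ℝ) < q := by exact_mod_cast hq
  rw [← Real.logb_self_eq_one hq1]
  refine logb_le_rhoSD hq hN (by positivity) fun C hC => ?_
  -- The clique consists of all letters, so no block avoids it and the error term vanishes.
  have := card_mul_card_le_of_clique_code (L := 1) hN (wordLists q 1)
    (fun w hw => mem_wordLists.1 hw) 1 (n - 1) (by omega) C hC ?_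
  · rw [card_wordLists] at this
    simp at this
    exact_mod_cast this
  · intro x y u v w hw w' hw' hne hx hy
    obtain ⟨a, rfl⟩ := List.length_eq_one_iff.1 (mem_wordLists.1 hw)
    obtain ⟨b, rfl⟩ := List.length_eq_one_iff.1 (mem_wordLists.1 hw')
    exact hNq.trans (le_card_sdBall_inter_of_one (by simpa using hx) (by simpa using hy))

theorem logb_le_rhoSD_two_four (n : ℕ) :
    Real.logb 2 (2 / (1 + 2 / 2 ^ (n / 2))) ≤ rhoSD 2 n 4 := by
  refine logb_le_rhoSD le_rfl (by norm_num) (by positivity) fun C hC => ?_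
  have := card_mul_card_le_of_clique_code (L := 2) (by norm_num) {[0, 1], [1, 0]} (by simp)
    (n / 2) (n % 2) (by omega) C hC ?_
  · have hK : ({[0, 1], [1, 0]} : Finset (List (Fin 2))).card = 2 := by decide
    rw [hK] at this
    have h : (2 : ℝ) * C.card ≤ 2 ^ n + 2 * (2 ^ (n / 2) * 2 ^ (n % 2)) := by exact_mod_cast this
    have hpow : (2 : ℝ) ^ n = 2 ^ (n / 2) * (2 ^ (n / 2) * 2 ^ (n % 2)) := by
      rw [← pow_add, ← pow_add]; congr 1; omega
    have hp : (0 : ℝ) < 2 ^ (n / 2) := by positivity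
    rw [div_mul_eq_mul_div, div_le_iff₀ (by positivity)]
    push_cast
    refine h.trans (le_of_eq ?_)
    rw [mul_add, mul_one]
    congr 1
    rw [hpow]; field_simp
  · intro x y u v w hw w' hw' hne hx hy
    simp only [Finset.mem_insert, Finset.mem_singleton] at hw hw'
    rcases hw with rfl | rfl <;> rcases hw' with rfl | rfl
    · exact absurd rfl hne
    · exact le_card_sdBall_inter_of_transposition (a := 0) (b := 1) (by decide) hx hy
    · exact le_card_sdBall_inter_of_transposition (a := 1) (b := 0) (by decide) hx hy
    · exact absurd rfl hne

/-- The word `b ⋯ b a b ⋯ b` of length `L` with `a` at position `i`. -/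
def unitWord {α : Type*} (a b : α) (L i : ℕ) : List α :=
  List.replicate i b ++ a :: List.replicate (L - 1 - i) b

theorem unitWord_eq_of_lt {α : Type*} (a b : α) {L i j : ℕ} (hij : i < j) (hj : j < L) :
    unitWord a b L i = List.replicate i b ++
      a :: (List.replicate (j - i - 1) b ++ b :: List.replicate (L - 1 - j) b) ∧
    unitWord a b L j = List.replicate i b ++
      b :: (List.replicate (j - i - 1) b ++ a :: List.replicate (L - 1 - j) b) := by
  constructor
  · rw [unitWord, ← List.replicate_succ, List.replicate_append_replicate]
    congr 3; omega
  · rw [unitWord, ← List.cons_append, ← List.replicate_succ, ← List.append_assoc,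
      List.replicate_append_replicate]
    congr 2; omega

/-- Any two unit words differ by moving a letter along a run, so they form a clique of size `L`.
With `q ^ L` disjoint blocks, the words avoiding the clique have density at most `1 / L`; the two
contributions give `L * |C| ≤ 2 * q ^ n`. -/
theorem logb_le_rhoSD_three {q n L : ℕ} (hq : 2 ≤ q) (hL : 0 < L) (hn : q ^ L * L ≤ n) :
    Real.logb q (L / 2) ≤ rhoSD q n 3 := by
  have hL0 : (0 : ℝ) < L := by exact_mod_cast hL
  refine logb_le_rhoSD hq (by norm_num) (by positivity) fun C hC => ?_
  let a : Fin q := ⟨1, hq⟩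
  let b : Fin q := ⟨0, by omega⟩
  have hab : a ≠ b := by simp [a, b]
  set K := (Finset.range L).image (unitWord a b L) with hKdef
  have hKcard : K.card = L := by
    rw [hKdef, Finset.card_image_of_injOn, Finset.card_range]
    have key : ∀ {i j}, i < j → j < L → unitWord a b L i ≠ unitWord a b L j := by
      intro i j hij hj h
      obtain ⟨h1, h2⟩ := unitWord_eq_of_lt a b hij hj
      rw [h1, h2] at h
      simp [hab] at h
    intro i hi j hj h
    simp only [Finset.coe_range, Set.mem_Iio] at hi hj
    rcases lt_trichotomy i j with hij | hij | hij
    · exact absurd h (key hij hj)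
    · exact hij
    · exact absurd h.symm (key hij hi)
  have := card_mul_card_le_of_clique_code (L := L) (by norm_num) K ?_ (q ^ L) (n - q ^ L * L)
    (by omega) C hC ?_
  · rw [hKcard] at this
    have hLq : L ≤ q ^ L := (Nat.lt_pow_self hq).le
    set Q : ℝ := (q : ℝ) ^ L with hQ
    have hQ0 : 0 < Q := by have : 0 < q := by omega
                           positivity
    have hLQ : (L : ℝ) ≤ Q := by rw [hQ]; exact_mod_cast hLq
    have h : (L : ℝ) * C.card ≤ (q : ℝ) ^ n +
        L * ((Q - L) ^ (q ^ L) * (q : ℝ) ^ (n - q ^ L * L)) := by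
      have h' : ((L * C.card : ℕ) : ℝ) ≤
        ((q ^ n + L * ((q ^ L - L) ^ q ^ L * q ^ (n - q ^ L * L)) : ℕ) : ℝ) := by
        exact_mod_cast this
      rw [hQ]
      push_cast [Nat.cast_sub hLq] at h'
      exact h'
    have hpow : (q : ℝ) ^ n = Q ^ (q ^ L) * (q : ℝ) ^ (n - q ^ L * L) := by
      rw [hQ, ← pow_mul, ← pow_add]; congr 1
      rw [mul_comm L]; omega
    -- `L (1 - L / Q) ^ Q ≤ 1` by Bernoulli's inequality
    have hbern : (L : ℝ) * (Q - L) ^ (q ^ L) ≤ Q ^ (q ^ L) := by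
      have h1 : 1 + ((q ^ L : ℕ) : ℝ) * (L / Q) ≤ (1 + L / Q) ^ (q ^ L) :=
        one_add_mul_le_pow (by have : 0 ≤ (L : ℝ) / Q := by positivity
                               linarith) _
      have h2 : ((q ^ L : ℕ) : ℝ) * (L / Q) = L := by
        rw [Nat.cast_pow, ← hQ]; field_simp
      rw [h2] at h1
      have h3 : (L : ℝ) ≤ (1 + L / Q) ^ (q ^ L) := by linarith
      have h4 : (0 : ℝ) ≤ (Q - L) ^ (q ^ L) := pow_nonneg (by linarith) _
      calc (L : ℝ) * (Q - L) ^ (q ^ L) ≤ (1 + L / Q) ^ (q ^ L) * (Q - L) ^ (q ^ L) :=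
            mul_le_mul_of_nonneg_right h3 h4
        _ = ((1 + L / Q) * (Q - L)) ^ (q ^ L) := (mul_pow _ _ _).symm
        _ ≤ Q ^ (q ^ L) := by
            refine pow_le_pow_left₀ (mul_nonneg (by positivity) (by linarith)) ?_ _
            have : (1 + L / Q) * (Q - L) = Q - L ^ 2 / Q := by field_simp; ring
            rw [this]
            have : 0 ≤ (L : ℝ) ^ 2 / Q := by positivity
            linarith
    have hr : (0 : ℝ) ≤ (q : ℝ) ^ (n - q ^ L * L) := by positivity
    have := mul_le_mul_of_nonneg_right hbern hr
    rw [← hpow] at this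
    linarith
  · intro w hw
    obtain ⟨i, hi, rfl⟩ := Finset.mem_image.1 hw
    have := Finset.mem_range.1 hi
    simp [unitWord]; omega
  · have key : ∀ (x y : Word q n) u v i j, i < j → j < L →
        List.ofFn x = u ++ (unitWord a b L i ++ v) → List.ofFn y = u ++ (unitWord a b L j ++ v) →
        3 ≤ (sdBall x ∩ sdBall y).card := by
      intro x y u v i j hij hj hx hy
      obtain ⟨h1, h2⟩ := unitWord_eq_of_lt a b hij hj
      rw [h1] at hx
      rw [h2] at hy
      exact le_card_sdBall_inter_of_shift (u := u ++ List.replicate i b)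
        (v := List.replicate (L - 1 - j) b ++ v) (j - i - 1) hab
        (by simpa using hx) (by simpa using hy)
    intro x y u v w hw w' hw' hne hx hy
    obtain ⟨i, hi, rfl⟩ := Finset.mem_image.1 hw
    obtain ⟨j, hj, rfl⟩ := Finset.mem_image.1 hw'
    rw [Finset.mem_range] at hi hj
    rcases lt_trichotomy i j with hij | rfl | hij
    · exact key x y u v i j hij hj hx hy
    · exact absurd rfl hne
    · rw [Finset.inter_comm]
      exact key y x u v j i hij hi hy hx

/-- Sphere packing: each codeword has `n` neighbours, one per position, given by a fixed-point-free
map `s` of the letters. A neighbour shared by two codewords puts them at distance 1 or 2, where the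
balls already meet in at least two words. -/
theorem logb_le_rhoSD_of_le_two {q n N : ℕ} (hq : 2 ≤ q) (hn : 0 < n) (hN : 0 < N)
    (hN2 : N ≤ 2) : Real.logb q n ≤ rhoSD q n N := by
  refine logb_le_rhoSD hq hN (by positivity) fun C hC => ?_
  have : Nontrivial (Fin q) := Fin.nontrivial_iff_two_le.2 hq
  choose s hs using fun a : Fin q => exists_ne a
  have hle : (C ×ˢ (Finset.univ : Finset (Fin n))).card ≤
      (Finset.univ : Finset (Word q n)).card := by
    refine Finset.card_le_card_of_injOn
      (fun p => Function.update p.1 p.2 (s (p.1 p.2))) (by simp) ?_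
    rintro ⟨x, i⟩ hx ⟨y, j⟩ hy h
    simp only [Finset.coe_product, Set.mem_prod, Finset.mem_coe] at hx hy h
    by_cases hxy : x = y
    · subst hxy
      by_contra hij
      have hij : i ≠ j := fun e => hij (by rw [e])
      have h' := congrFun h i
      simp only [Function.update_self, Function.update_of_ne hij] at h'
      exact hs _ h'
    · exfalso
      have hlt := (isReconstructionCode_iff hN).1 hC x hx.1 y hy.1 hxy
      have h1 := isSubst_ofFn_update x i (s (x i))
      have h2 := isSubst_ofFn_update y j (s (y j))
      rw [← h] at h2
      rcases exists_of_isSubst_common (List.ofFn_injective.ne hxy) h1 h2 with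
        ⟨u, a, b, v, hab, hx, hy⟩ | ⟨u, a, a', w, b, b', v, ha, hb, hx, hy⟩
      · have := le_card_sdBall_inter_of_one hx hy
        omega
      · have := le_card_sdBall_inter_of_two ha hx hy
        omega
  simp [Finset.card_product] at hle
  rw [mul_comm]
  exact_mod_cast hle

/-! ### Upper bounds on the redundancy -/

theorem eq_of_zmod_eq {M : ℕ} {s t : ℤ} (h : (s : ZMod M) = t) (hlt : |s - t| < M) : s = t := by
  have hd : (M : ℤ) ∣ s - t := (ZMod.intCast_eq_intCast_iff_dvd_sub t s M).1 h.symm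
  have := Int.eq_zero_of_abs_lt_dvd hd hlt
  omega

/-- The value of a letter as an integer. -/
def letterVal {q : ℕ} (a : Fin q) : ℤ := ((a : ℕ) : ℤ)

theorem letterVal_nonneg {q : ℕ} (a : Fin q) : 0 ≤ letterVal a := Int.natCast_nonneg _

theorem letterVal_lt {q : ℕ} (a : Fin q) : letterVal a < q := by
  simp [letterVal]

theorem letterVal_inj {q : ℕ} {a b : Fin q} : letterVal a = letterVal b ↔ a = b := by
  simp [letterVal, Fin.ext_iff]

theorem abs_letterVal_sub_lt {q : ℕ} (a b : Fin q) : |letterVal a - letterVal b| < q := by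
  have := letterVal_nonneg a; have := letterVal_nonneg b
  have := letterVal_lt a; have := letterVal_lt b
  rw [abs_lt]; constructor <;> linarith

theorem rhoSD_nonneg {q n N : ℕ} (hq : 2 ≤ q) (hN : 0 < N) : 0 ≤ rhoSD q n N := by
  rw [← Real.logb_one (b := (q : ℝ))]
  refine logb_le_rhoSD hq hN one_pos fun C _ => ?_
  have := Finset.card_le_univ C
  simp at this
  rw [one_mul]
  exact_mod_cast this

theorem rhoSD_eq_zero {q n N : ℕ} (hq : 2 ≤ q) (hN : 5 ≤ N) (hqN : q + 2 ≤ N) :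
    rhoSD q n N = 0 := by
  refine le_antisymm ?_ (rhoSD_nonneg hq (by omega))
  have := rhoSD_le_logb (n := n) (N := N) (k := 1) (T := Unit) hq (by omega) Finset.univ (by simp)
    (fun _ => ()) ?_
  · simpa using this
  · intro x _ y _ _ hxy
    have := card_deletionBall_inter_le_two hxy
    exact card_sdBall_inter_lt hxy (fun _ _ _ _ _ _ _ => by omega)
      (fun _ _ _ _ _ _ _ _ _ _ _ => by omega) (by omega)

/-- The letter sum of a word modulo `M`. -/
def sumMod (M : ℕ) {q n : ℕ} (φ : Fin q → ℤ) (x : Word q n) : ZMod M :=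
  ((((List.ofFn x).map φ).sum : ℤ) : ZMod M)

/-- The first moment of a word modulo `M`. -/
def momentMod (M : ℕ) {q n : ℕ} (φ : Fin q → ℤ) (x : Word q n) : ZMod M :=
  ((moment φ (List.ofFn x) : ℤ) : ZMod M)

theorem letter_eq_of_sumMod_eq {q n : ℕ} {x y : Word q n} {u v : List (Fin q)} {a b : Fin q}
    (h : sumMod q letterVal x = sumMod q letterVal y) (hx : List.ofFn x = u ++ a :: v)
    (hy : List.ofFn y = u ++ b :: v) : a = b := by
  have hd := sum_sub_sum_shift letterVal u [] v a b
  have := eq_of_zmod_eq h (by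
    rw [hx, hy]
    exact lt_of_eq_of_lt (congrArg abs hd) (abs_letterVal_sub_lt a b))
  rw [hx, hy] at this
  simp only [List.nil_append] at hd
  rw [← letterVal_inj]
  linarith

theorem rhoSD_le_one {q n N : ℕ} (hq : 2 ≤ q) (hN : 5 ≤ N) : rhoSD q n N ≤ 1 := by
  have : NeZero q := ⟨by omega⟩
  have := rhoSD_le_logb (n := n) (N := N) (k := 1) hq (by omega) Finset.univ (by simp)
    (sumMod q letterVal) ?_
  · rwa [one_mul, ZMod.card, Real.logb_self_eq_one (by exact_mod_cast hq)] at this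
  · intro x _ y _ h hxy
    have := card_deletionBall_inter_le_two hxy
    exact card_sdBall_inter_lt hxy
      (fun u a b v hab hx hy => absurd (letter_eq_of_sumMod_eq h hx hy) hab)
      (fun _ _ _ _ _ _ _ _ _ _ _ => by omega) (by omega)

/-- Beyond distance 1, only adjacent transpositions reach 4 common words, and they change the moment
by a nonzero letter difference, which is less than `q` in absolute value. -/
theorem card_sdBall_inter_lt_four {q n : ℕ} {x y : Word q n} (hxy : x ≠ y)
    (h : momentMod q letterVal x = momentMod q letterVal y)
    (h₁ : ∀ u a b v, a ≠ b → List.ofFn x = u ++ a :: v → List.ofFn y = u ++ b :: v → q + 1 < 4) :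
    (sdBall x ∩ sdBall y).card < 4 := by
  have hD := card_deletionBall_inter_le_two hxy
  refine card_sdBall_inter_lt hxy h₁ (fun u a a' w b b' v ha hb hx hy => ?_) (by omega)
  by_contra hcon
  obtain ⟨rfl, rfl, rfl⟩ := adjacent_transposition_of_two_le_card ha hb hx hy (by omega)
  have hd := moment_sub_moment_two letterVal u [] v b' b b b'
  have hd' : moment letterVal (List.ofFn x) - moment letterVal (List.ofFn y) =
      letterVal b - letterVal b' := by
    rw [hx, hy, hd]; push_cast [List.length_nil]; ring
  have := eq_of_zmod_eq h (by rw [hd']; exact abs_letterVal_sub_lt _ _)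
  exact ha (letterVal_inj.1 (by linarith))

theorem rhoSD_two_four_le (n : ℕ) : rhoSD 2 n 4 ≤ 1 := by
  have := rhoSD_le_logb (n := n) (N := 4) (k := 1) le_rfl (by omega) Finset.univ (by simp)
    (momentMod 2 letterVal) ?_
  · simpa using this
  · intro x _ y _ h hxy
    exact card_sdBall_inter_lt_four hxy h (fun _ _ _ _ _ _ _ => by omega)

theorem rhoSD_four_le {q : ℕ} (hq : 2 ≤ q) (n : ℕ) : rhoSD q n 4 ≤ 2 := by
  have : NeZero q := ⟨by omega⟩
  have hq1 : (1 : ℝ) < q := by exact_mod_cast hq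
  have := rhoSD_le_logb (n := n) (N := 4) (k := 1) hq (by omega) Finset.univ (by simp)
    (fun x => (sumMod q letterVal x, momentMod q letterVal x)) ?_
  · rw [one_mul, Fintype.card_prod, ZMod.card, ← pow_two, Nat.cast_pow, Real.logb_pow,
      Real.logb_self_eq_one hq1] at this
    simpa using this
  · intro x _ y _ h hxy
    simp only [Prod.mk.injEq] at h
    exact card_sdBall_inter_lt_four hxy h.2
      (fun u a b v hab hx hy => absurd (letter_eq_of_sumMod_eq h.1 hx hy) hab)

/-! ### Rich words and the case N = 3 -/

/-- Words in which each window of length at least `t` contains all letters. -/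
def IsRich {q : ℕ} (t : ℕ) (x : List (Fin q)) : Prop :=
  ∀ w, w <:+: x → t ≤ w.length → ∀ c, c ∈ w

open Classical in
/-- The words of length `n` in which each window of length at least `t` contains all letters. -/
noncomputable def richWords (q n t : ℕ) : Finset (Word q n) :=
  Finset.univ.filter fun x => IsRich t (List.ofFn x)

theorem mem_richWords {q n t : ℕ} {x : Word q n} :
    x ∈ richWords q n t ↔ IsRich t (List.ofFn x) := by
  simp [richWords]

theorem card_window {n i t : ℕ} (h : i + t ≤ n) :
    (Finset.univ.filter fun k : Fin n => i ≤ k ∧ (k : ℕ) < i + t).card = t := by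
  rw [← Finset.card_map Fin.valEmbedding]
  have : (Finset.univ.filter fun k : Fin n => i ≤ k ∧ (k : ℕ) < i + t).map Fin.valEmbedding =
      Finset.Ico i (i + t) := by
    ext k
    simp only [Finset.mem_map, Finset.mem_filter, Finset.mem_univ, true_and, Fin.valEmbedding_apply,
      Finset.mem_Ico]
    constructor
    · rintro ⟨k, hk, rfl⟩; exact hk
    · intro hk; exact ⟨⟨k, by omega⟩, hk, rfl⟩
  rw [this]; simp

theorem card_avoiding {q n i t : ℕ} (h : i + t ≤ n) (c : Fin q) :
    (Fintype.piFinset fun k : Fin n => if i ≤ k ∧ (k : ℕ) < i + t then ({c}ᶜ : Finset (Fin q))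
      else Finset.univ).card = (q - 1) ^ t * q ^ (n - t) := by
  rw [Fintype.card_piFinset]
  have : ∀ k : Fin n, (if i ≤ k ∧ (k : ℕ) < i + t then ({c}ᶜ : Finset (Fin q))
      else Finset.univ).card = if i ≤ k ∧ (k : ℕ) < i + t then q - 1 else q := by
    intro k; split_ifs <;> simp [Finset.card_compl]
  simp only [this]
  rw [Finset.prod_ite, Finset.prod_const, Finset.prod_const, card_window h]
  congr 2
  have := Finset.card_filter_add_card_filter_not (s := (Finset.univ : Finset (Fin n)))
    (fun k : Fin n => i ≤ k ∧ (k : ℕ) < i + t)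
  rw [card_window h] at this
  simp only [Finset.card_univ, Fintype.card_fin] at this
  omega

/-- Union bound over the start of a bad window and the letter missing from it; the first `t`
positions of the window suffice. -/
theorem card_richWords_compl_le {q n t : ℕ} (ht : 0 < t) :
    (richWords q n t)ᶜ.card ≤ (n * q) * ((q - 1) ^ t * q ^ (n - t)) := by
  classical
  let S : Finset (Fin n × Fin q) := Finset.univ.filter fun p => (p.1 : ℕ) + t ≤ n
  have hsub : (richWords q n t)ᶜ ⊆ S.biUnion fun p =>
      Fintype.piFinset fun k : Fin n => if (p.1 : ℕ) ≤ k ∧ (k : ℕ) < p.1 + t then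
        ({p.2}ᶜ : Finset (Fin q)) else Finset.univ := by
    intro x hx
    rw [Finset.mem_compl, mem_richWords, IsRich] at hx
    push Not at hx
    obtain ⟨w, ⟨s, r, hsr⟩, hw, c, hc⟩ := hx
    have hl := congrArg List.length hsr
    simp at hl
    rw [Finset.mem_biUnion]
    refine ⟨(⟨s.length, by omega⟩, c), by simp [S]; omega, ?_⟩
    rw [Fintype.mem_piFinset]
    intro k
    split_ifs with hk
    · simp only [Finset.mem_compl, Finset.mem_singleton]
      rintro rfl
      apply hc
      have h1 : (s ++ w ++ r)[(k : ℕ)]? = some (x k) := by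
        rw [hsr]; simp
      rw [List.append_assoc, List.getElem?_append_right hk.1,
        List.getElem?_append_left (by have := hk.2; simp only at this; omega)] at h1
      exact List.mem_of_getElem? h1
    · simp
  refine (Finset.card_le_card hsub).trans (Finset.card_biUnion_le.trans ?_)
  refine (Finset.sum_le_card_nsmul _ _ _ fun p hp => ?_).trans
    (Nat.mul_le_mul_right ((q - 1) ^ t * q ^ (n - t)) (?_ : S.card ≤ n * q))
  · exact (card_avoiding (by simpa [S] using hp) p.2).le
  · exact (Finset.card_le_univ S).trans (by simp)

/-- A window length, logarithmic in `n`, for which most words are rich. -/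
def richLength (q n : ℕ) : ℕ := q * (q * (Nat.log q n + 3))

/-- Bernoulli's inequality gives `(1 + 1 / (q - 1)) ^ q ≥ 2`. Hence every `q` further positions at
least halve the chance of avoiding a letter. -/
theorem two_mul_pred_pow_self_le {q : ℕ} (hq : 2 ≤ q) : 2 * (q - 1) ^ q ≤ q ^ q := by
  obtain ⟨p, rfl⟩ : ∃ p, q = p + 1 := ⟨q - 1, by omega⟩
  have hp : (0 : ℝ) < p := by exact_mod_cast (by omega : 0 < p)
  have h := one_add_mul_le_pow (a := (1 : ℝ) / p) (by have : 0 ≤ (1 : ℝ) / p := by positivity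
                                                      linarith) (p + 1)
  have h2 : (2 : ℝ) ≤ 1 + ((p + 1 : ℕ) : ℝ) * (1 / p) := by
    have : ((p + 1 : ℕ) : ℝ) * (1 / p) = 1 + 1 / p := by push_cast; field_simp
    rw [this]
    have : 0 ≤ (1 : ℝ) / p := by positivity
    linarith
  have h3 : (2 : ℝ) * (p : ℝ) ^ (p + 1) ≤ ((p : ℝ) + 1) ^ (p + 1) := by
    calc (2 : ℝ) * (p : ℝ) ^ (p + 1) ≤ (1 + 1 / p) ^ (p + 1) * (p : ℝ) ^ (p + 1) :=
          mul_le_mul_of_nonneg_right (h2.trans h) (by positivity)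
      _ = ((p : ℝ) + 1) ^ (p + 1) := by rw [← mul_pow]; congr 1; field_simp
  rw [Nat.add_sub_cancel]
  exact_mod_cast h3

theorem two_mul_pred_pow_richLength_le {q : ℕ} (hq : 2 ≤ q) (n : ℕ) :
    2 * (n * q) * (q - 1) ^ richLength q n ≤ q ^ richLength q n := by
  set m := Nat.log q n + 3 with hm
  have h1 : (2 * (q - 1) ^ q) ^ (q * m) ≤ (q ^ q) ^ (q * m) :=
    Nat.pow_le_pow_left (two_mul_pred_pow_self_le hq) _
  rw [mul_pow, ← pow_mul, ← pow_mul] at h1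
  refine le_trans (Nat.mul_le_mul_right _ ?_) h1
  have h2 : q ^ m ≤ 2 ^ (q * m) := by
    rw [pow_mul]; exact Nat.pow_le_pow_left Nat.lt_two_pow_self.le _
  have h3 : n < q ^ (Nat.log q n + 1) := Nat.lt_pow_succ_log_self hq n
  have h4 : q ^ m = q ^ (Nat.log q n + 1) * (q * q) := by rw [hm]; ring
  calc 2 * (n * q) = n * (2 * q) := by ring
    _ ≤ q ^ (Nat.log q n + 1) * (q * q) := Nat.mul_le_mul h3.le (Nat.mul_le_mul_right _ hq)
    _ ≤ 2 ^ (q * m) := h4 ▸ h2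

theorem pow_le_two_mul_card_richWords {q : ℕ} (hq : 2 ≤ q) (n : ℕ) :
    q ^ n ≤ 2 * (richWords q n (richLength q n)).card := by
  set t := richLength q n with ht
  have htpos : 0 < t := by rw [ht, richLength]; positivity
  have htot := Finset.card_add_card_compl (richWords q n t)
  simp only [Fintype.card_pi, Fintype.card_fin, Finset.prod_const, Finset.card_univ] at htot
  rcases le_or_gt t n with htn | htn
  · have h1 := card_richWords_compl_le (q := q) (n := n) htpos
    have h2 := Nat.mul_le_mul_right (q ^ (n - t)) (two_mul_pred_pow_richLength_le hq n)
    rw [← ht, ← pow_add, Nat.add_sub_cancel' htn] at h2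
    have h3 : 2 * ((n * q) * ((q - 1) ^ t * q ^ (n - t))) =
      2 * (n * q) * (q - 1) ^ t * q ^ (n - t) := by ring
    omega
  · have : richWords q n t = Finset.univ := by
      ext x
      simp only [mem_richWords, Finset.mem_univ, iff_true]
      intro w hw hwt
      have := hw.length_le
      simp at this
      omega
    rw [this]
    simp
    omega

theorem IsRich.length_lt {q t : ℕ} {x u v : List (Fin q)} {s : ℕ} {c d : Fin q} (h : IsRich t x)
    (hcd : d ≠ c) (hx : x = u ++ (List.replicate s c ++ v)) : s < t := by
  by_contra hcon
  have := h (List.replicate s c) ⟨u, v, by simp [hx]⟩ (by simp; omega) d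
  exact hcd (List.eq_of_mem_replicate this)

theorem rhoSD_three_le {q : ℕ} (hq : 2 ≤ q) (n : ℕ) :
    rhoSD q n 3 ≤ Real.logb q ((2 * (q * (q * richLength q n)) : ℕ) : ℝ) := by
  set t := richLength q n with ht
  have htpos : 0 < t := by rw [ht, richLength]; positivity
  have : NeZero q := ⟨by omega⟩
  have : NeZero (q * t) := ⟨by positivity⟩
  have := rhoSD_le_logb (n := n) (N := 3) (k := 2) hq (by omega) (richWords q n t)
    (pow_le_two_mul_card_richWords hq n)
    (fun x => (sumMod q letterVal x, momentMod (q * t) letterVal x)) ?_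
  · rwa [Fintype.card_prod, ZMod.card, ZMod.card] at this
  · intro x hxr y _ h hxy
    rw [mem_richWords] at hxr
    simp only [Prod.mk.injEq] at h
    have hD := card_deletionBall_inter_le_two hxy
    refine card_sdBall_inter_lt hxy
      (fun u a b v hab hx hy => absurd (letter_eq_of_sumMod_eq h.1 hx hy) hab)
      (fun u a a' w b b' v ha hb hx hy => ?_) (by omega)
    by_contra hcon
    obtain ⟨z, hz⟩ : (deletionBall x ∩ deletionBall y).Nonempty := by
      rw [← Finset.card_pos]; omega
    simp only [Finset.mem_inter, mem_deletionBall, hx, hy] at hz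
    have hsum := sum_sub_sum_two letterVal u w v a a' b b'
    have hmom := moment_sub_moment_two letterVal u w v a a' b b'
    rw [← hx, ← hy] at hsum hmom
    obtain ⟨c, hc, hw⟩ := exists_replicate_of_isDel_common ha hb hz.1 hz.2
    -- The letter `d` crosses a run of `c` of length `w.length + 1 < t`, so the moment changes by a
    -- nonzero amount below `q * t`. The sign `ε` records which word has the run on the right.
    have key : ∀ d, d ≠ c → w.length + 1 < t → ∀ ε : ℤ, |ε| = 1 →
        moment letterVal (List.ofFn x) - moment letterVal (List.ofFn y) =
          ε * ((w.length + 1) * (letterVal d - letterVal c)) → False := by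
      intro d hd hlt ε hε he
      have habs : |ε * (((w.length : ℤ) + 1) * (letterVal d - letterVal c))| < (q * t : ℕ) := by
        rw [abs_mul, hε, one_mul, abs_mul, abs_of_nonneg (by positivity), mul_comm]
        push_cast
        exact mul_lt_mul'' (abs_letterVal_sub_lt _ _) (by exact_mod_cast hlt) (abs_nonneg _)
          (by positivity)
      have h0 := eq_of_zmod_eq h.2 (by rw [he]; exact habs)
      rw [h0, sub_self] at he
      have hε0 : ε ≠ 0 := by rintro rfl; simp at hε
      have hl : (w.length : ℤ) + 1 ≠ 0 := by positivity
      have := (mul_eq_zero.1 ((mul_eq_zero.1 he.symm).resolve_left hε0)).resolve_left hl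
      exact hd (letterVal_inj.1 (by linarith))
    rcases hc with ⟨rfl, rfl⟩ | ⟨rfl, rfl⟩
    · have hs : (sumMod q letterVal x) = sumMod q letterVal y := h.1
      have := eq_of_zmod_eq hs (by
        rw [hsum, show letterVal a - letterVal c + (letterVal c - letterVal b') =
          letterVal a - letterVal b' by ring]
        exact abs_letterVal_sub_lt _ _)
      obtain rfl : a = b' := letterVal_inj.1 (by linarith)
      refine key a ha (hxr.length_lt (u := u ++ [a]) (v := v) (c := c) ha ?_) (-1) (by simp)
        (by rw [hmom]; ring)
      rw [hx, List.replicate_succ', ← hw]; simp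
    · have hs : (sumMod q letterVal x) = sumMod q letterVal y := h.1
      have := eq_of_zmod_eq hs (by
        rw [hsum, show letterVal c - letterVal a' + (letterVal b - letterVal c) =
          letterVal b - letterVal a' by ring]
        exact abs_letterVal_sub_lt _ _)
      obtain rfl : b = a' := letterVal_inj.1 (by linarith)
      refine key b ha.symm (hxr.length_lt (u := u) (v := b :: v) (c := c) ha.symm ?_) 1 (by simp)
        (by rw [hmom]; ring)
      rw [hx, List.replicate_succ, ← hw]; simp

/-! ### Codes that correct a substitution or a deletion -/

/-- Within a fibre the balls become disjoint, so any positive `N` is allowed. `h₃` treats one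
direction of the shift; the other follows by exchanging the words. -/
theorem rhoSD_le_logb_of_separated {q n N k : ℕ} {T : Type*} [Fintype T] [DecidableEq T]
    (hq : 2 ≤ q) (hN : 0 < N) (G : Finset (Word q n)) (hG : q ^ n ≤ k * G.card)
    (f : Word q n → T)
    (h₁ : ∀ x y, f x = f y → ∀ u a b v, List.ofFn x = u ++ a :: v → List.ofFn y = u ++ b :: v →
      a = b)
    (h₂ : ∀ x y, f x = f y → ∀ u a a' w b b' v, a ≠ a' → b ≠ b' →
      List.ofFn x = u ++ a :: (w ++ b :: v) → List.ofFn y = u ++ a' :: (w ++ b' :: v) → False)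
    (h₃ : ∀ x ∈ G, ∀ y, f x = f y → ∀ u a w b v, List.ofFn x = u ++ a :: (w ++ v) →
      List.ofFn y = u ++ (w ++ b :: v) → List.ofFn x = List.ofFn y) :
    rhoSD q n N ≤ Real.logb q ((k * Fintype.card T : ℕ) : ℝ) := by
  refine rhoSD_le_logb hq hN G hG f fun x hx y hy h hxy => ?_
  refine card_sdBall_inter_lt hxy (fun u a b v hab hx hy => absurd (h₁ x y h u a b v hx hy) hab)
    (fun u a a' w b b' v ha hb hx hy => (h₂ x y h u a a' w b b' v ha hb hx hy).elim) ?_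
  refine lt_of_le_of_lt (le_of_eq ?_) hN
  rw [Finset.card_eq_zero, Finset.eq_empty_iff_forall_notMem]
  intro z hz
  simp only [Finset.mem_inter, mem_deletionBall] at hz
  apply List.ofFn_injective.ne hxy
  obtain ⟨u, a, w, b, v, ⟨e1, e2⟩ | ⟨e1, e2⟩⟩ := exists_of_isDel_common hz.1 hz.2
  · exact h₃ x hx y h u a w b v e1 e2
  · exact (h₃ y hy x h.symm u a w b v e1 e2).symm

theorem eq_replicate_of_length_mul_le_sum {α : Type*} (φ : α → ℤ) (hφ : Function.Injective φ)
    {w : List α} {b : α} (h : ∀ c ∈ w, φ c ≤ φ b) (hs : w.length * φ b ≤ (w.map φ).sum) :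
    w = List.replicate w.length b := by
  induction w with
  | nil => rfl
  | cons c w ih =>
    have hle : (w.map φ).sum ≤ w.length * φ b := by
      have := List.sum_le_card_nsmul (w.map φ) (φ b) (by
        intro m hm
        obtain ⟨d, hd, rfl⟩ := List.mem_map.1 hm
        exact h d (List.mem_cons_of_mem _ hd))
      simpa using this
    simp only [List.length_cons, List.map_cons, List.sum_cons] at hs
    push_cast at hs
    have hc := h c List.mem_cons_self
    have hcb : c = b := hφ (by linarith)
    have := ih (fun d hd => h d (List.mem_cons_of_mem _ hd)) (by rw [hcb] at hs; linarith)
    rw [List.length_cons, List.replicate_succ, ← this, hcb]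

theorem cons_append_eq_of_eq_replicate {α : Type*} {a : α} {w : List α}
    (h : w = List.replicate w.length a) (v : List α) : a :: (w ++ v) = w ++ a :: v := by
  rw [h, ← List.cons_append, ← List.replicate_succ, List.replicate_succ']
  simp

theorem rhoSD_two_le {N : ℕ} (hN : 0 < N) (n : ℕ) :
    rhoSD 2 n N ≤ Real.logb 2 ((2 * n + 1 : ℕ) : ℝ) := by
  have hval : ∀ a : Fin 2, letterVal a = 0 ∨ letterVal a = 1 := by decide
  have := rhoSD_le_logb_of_separated (n := n) (N := N) (k := 1) le_rfl hN Finset.univ (by simp)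
    -- Changing two letters moves the moment by less than `2 * n`, so the congruence becomes an
    -- equality. Two changed positions then cannot cancel, being distinct and positive. For a shift,
    -- equality forces `a = b` and every letter of `w` to be `a`.
    (momentMod (2 * n + 1) letterVal) ?_ ?_ ?_
  · simpa using this
  · intro x y h u a b v hx hy
    have hl := congrArg List.length hx
    simp at hl
    have hd := moment_sub_moment_shift letterVal u [] v a b
    simp only [List.nil_append] at hd
    rw [← hx, ← hy] at hd
    have h0 := eq_of_zmod_eq h (by
      rw [hd, abs_lt]
      simp
      rcases hval a with e | e <;> rcases hval b with f | f <;> rw [e, f] <;>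
        constructor <;> omega)
    rw [h0] at hd
    simp at hd
    rw [← letterVal_inj]
    rcases hd with hd | hd <;> omega
  · intro x y h u a a' w b b' v ha hb hx hy
    have hl := congrArg List.length hx
    simp at hl
    have hd := moment_sub_moment_two letterVal u w v a a' b b'
    rw [← hx, ← hy] at hd
    rw [← letterVal_inj.ne] at ha hb
    have h0 := eq_of_zmod_eq h (by
      rw [hd, abs_lt]
      rcases hval a with e | e <;> rcases hval b with f | f <;>
      rcases hval a' with e' | e' <;> rcases hval b' with f' | f' <;>
        rw [e, f, e', f'] <;> constructor <;> push_cast <;> omega)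
    rw [h0] at hd
    rcases hval a with e | e <;> rcases hval b with f | f <;>
      rcases hval a' with e' | e' <;> rcases hval b' with f' | f' <;>
      rw [e, e'] at ha <;> rw [f, f'] at hb <;> rw [e, f, e', f'] at hd <;> omega
  · intro x _ y h u a w b v hx hy
    have hl := congrArg List.length hx
    simp at hl
    have hd := moment_sub_moment_shift letterVal u w v a b
    rw [← hx, ← hy] at hd
    have hs0 : 0 ≤ (w.map letterVal).sum := List.sum_nonneg (by
      intro m hm
      obtain ⟨c, -, rfl⟩ := List.mem_map.1 hm
      exact letterVal_nonneg c)
    have hs1 : (w.map letterVal).sum ≤ w.length := by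
      have := List.sum_le_card_nsmul (w.map letterVal) 1 (by
        intro m hm
        obtain ⟨c, -, rfl⟩ := List.mem_map.1 hm
        rcases hval c with e | e <;> omega)
      simpa using this
    have h0 := eq_of_zmod_eq h (by
      rw [hd, abs_lt]
      rcases hval a with e | e <;> rcases hval b with f | f <;> rw [e, f] <;>
        constructor <;> push_cast <;> omega)
    rw [h0] at hd
    have hab : a = b := by
      rw [← letterVal_inj]
      rcases hval a with e | e <;> rcases hval b with f | f <;> rw [e, f] at hd ⊢ <;> omega
    subst hab
    have hw : w = List.replicate w.length a := by
      rcases hval a with e | e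
      · refine eq_replicate_of_length_mul_le_sum (fun c => -letterVal c)
          (fun c d hcd => letterVal_inj.1 (by simpa using hcd)) (fun c _ => ?_) ?_
        · have := letterVal_nonneg c
          rw [e]; omega
        · have hneg : (w.map fun c => -letterVal c).sum = -(w.map letterVal).sum := by
            rw [List.sum_neg, List.map_map]; rfl
          rw [hneg]
          rw [e] at hd ⊢
          omega
      · refine eq_replicate_of_length_mul_le_sum letterVal
          (fun c d hcd => letterVal_inj.1 hcd) (fun c _ => ?_) ?_
        · rcases hval c with e' | e' <;> omega
        · rw [e] at hd ⊢
          omega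
    rw [hx, hy, cons_append_eq_of_eq_replicate hw]

/-! ### Power weights and codes over larger alphabets -/

/-- The value `B ^ a` of a letter `a`. -/
def powVal (B : ℕ) {q : ℕ} (a : Fin q) : ℤ := (B : ℤ) ^ (a : ℕ)

theorem powVal_pos {B q : ℕ} (hB : 0 < B) (a : Fin q) : 0 < powVal B a := by
  have : (0 : ℤ) < B := by exact_mod_cast hB
  exact pow_pos this _

theorem powVal_le {B q : ℕ} (hB : 0 < B) (a : Fin q) : powVal B a ≤ (B ^ (q - 1) : ℕ) := by
  have := Nat.pow_le_pow_right hB (show (a : ℕ) ≤ q - 1 by omega)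
  rw [powVal]; exact_mod_cast this

theorem powVal_strictMono {B q : ℕ} (hB : 1 < B) : StrictMono (powVal B (q := q)) := by
  intro a b hab
  exact pow_lt_pow_right₀ (by exact_mod_cast hB) hab

theorem mul_powVal_le {B q : ℕ} (hB : 0 < B) {a b : Fin q} (h : b < a) :
    B * powVal B b ≤ powVal B a := by
  have := Nat.pow_le_pow_right hB (show (b : ℕ) + 1 ≤ a from h)
  rw [powVal, powVal, ← pow_succ']; exact_mod_cast this

theorem sum_powVal_nonneg {B q : ℕ} (hB : 0 < B) (w : List (Fin q)) :
    0 ≤ (w.map (powVal B)).sum := List.sum_nonneg (by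
  intro m hm
  obtain ⟨c, -, rfl⟩ := List.mem_map.1 hm
  exact (powVal_pos hB c).le)

theorem mul_powVal_le_sum {B q : ℕ} (hB : 0 < B) {w : List (Fin q)} {b c : Fin q} (hc : c ∈ w)
    (h : b < c) : B * powVal B b ≤ (w.map (powVal B)).sum := by
  refine (mul_powVal_le hB h).trans (List.single_le_sum ?_ _ (List.mem_map_of_mem hc))
  intro m hm
  obtain ⟨c, -, rfl⟩ := List.mem_map.1 hm
  exact (powVal_pos hB c).le

/-- A long window of a rich word has a large letter sum. -/
theorem IsRich.length_mul_lt_sum {q t : ℕ} (ht : 0 < t) {b c : Fin q} (hbc : b < c) :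
    ∀ {w : List (Fin q)}, IsRich t w → t ≤ w.length →
      w.length * powVal (2 * t) b < (w.map (powVal (2 * t))).sum := by
  have hB : 0 < 2 * t := by omega
  have hb := powVal_pos hB b
  intro w
  induction hn : w.length using Nat.strong_induction_on generalizing w with
  | _ n ih =>
    intro hw htw
    -- Windows of length `t` are split off until fewer than `2 * t` letters remain. Each piece
    -- contains a `c`, of weight at least `2 * t` times that of `b`; the factor 2 pays for the last,
    -- longer piece.
    rcases lt_or_ge n (2 * t) with h | h
    · refine lt_of_lt_of_le ?_ (mul_powVal_le_sum hB (hw w List.infix_rfl (by omega) c) hbc)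
      exact mul_lt_mul_of_pos_right (by exact_mod_cast h) hb
    · have hdl : (w.drop t).length = n - t := by simp [hn]
      have h1 := ih (n - t) (by omega) hdl
        (fun s hs => hw s (hs.trans (List.drop_suffix t w).isInfix)) (by omega)
      have h2 := mul_powVal_le_sum hB (hw (w.take t) (List.take_prefix t w).isInfix
        (by simp; omega) c) hbc
      have hsum : (w.map (powVal (2 * t))).sum =
          ((w.take t).map (powVal (2 * t))).sum + ((w.drop t).map (powVal (2 * t))).sum := by
        rw [← List.sum_append, ← List.map_append, List.take_append_drop]
      have hcast : ((n - t : ℕ) : ℤ) = n - t := by push_cast [Nat.cast_sub (by omega : t ≤ n)]; ring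
      rw [hcast] at h1
      push_cast at h2
      have : 0 ≤ (t : ℤ) * powVal (2 * t) b := by positivity
      rw [hsum]
      linarith

/-- A letter above `b` would make the sum too large: in a short block its weight alone exceeds the
total, and in a long block richness repeats it often enough. With all letters at most `b`, equality
leaves only `b`. -/
theorem IsRich.eq_replicate {q t : ℕ} (ht : 0 < t) {w : List (Fin q)} (hw : IsRich t w)
    {b : Fin q} (h : (w.map (powVal (2 * t))).sum = w.length * powVal (2 * t) b) :
    w = List.replicate w.length b := by
  have hB : 0 < 2 * t := by omega
  have hmono := powVal_strictMono (B := 2 * t) (q := q) (by omega)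
  by_cases hle : ∀ c ∈ w, c ≤ b
  · exact eq_replicate_of_length_mul_le_sum _ hmono.injective
      (fun c hc => hmono.monotone (hle c hc)) h.ge
  · exfalso
    push Not at hle
    obtain ⟨c, hc, hbc⟩ := hle
    rcases lt_or_ge w.length t with hl | hl
    · have h1 := mul_powVal_le_sum hB hc hbc
      rw [h] at h1
      have := le_of_mul_le_mul_right h1 (powVal_pos hB b)
      norm_cast at this
      omega
    · exact (hw.length_mul_lt_sum ht hbc hl).ne' h

theorem abs_powVal_sub_le {B q : ℕ} (hB : 0 < B) (a b : Fin q) :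
    |powVal B a - powVal B b| ≤ (B ^ (q - 1) : ℕ) := by
  have := powVal_pos hB a; have := powVal_pos hB b
  have := powVal_le hB a; have := powVal_le hB b
  rw [abs_le]; constructor <;> linarith

theorem rhoSD_le_logb_richLength {q N : ℕ} (hq : 2 ≤ q) (hN : 0 < N) (n : ℕ) :
    rhoSD q n N ≤ Real.logb q ((2 * ((2 * (2 * richLength q n) ^ (q - 1) + 1) *
      (n * (2 * richLength q n) ^ (q - 1) + 1)) : ℕ) : ℝ) := by
  set t := richLength q n with ht
  have htpos : 0 < t := by rw [ht, richLength]; positivity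
  have hB : 0 < 2 * t := by omega
  have hmono := powVal_strictMono (B := 2 * t) (q := q) (by omega)
  set P := (2 * t) ^ (q - 1) with hP
  have hab : ∀ a b : Fin q, |powVal (2 * t) a - powVal (2 * t) b| ≤ (P : ℤ) :=
    abs_powVal_sub_le hB
  have := rhoSD_le_logb_of_separated (n := n) (N := N) (k := 2) hq hN (richWords q n t)
    (pow_le_two_mul_card_richWords hq n) (fun x => (sumMod (2 * P + 1) (powVal (2 * t)) x,
      momentMod (n * P + 1) (powVal (2 * t)) x)) ?_ ?_ ?_
  · rwa [Fintype.card_prod, ZMod.card, ZMod.card] at this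
  · intro x y h u a b v hx hy
    simp only [Prod.mk.injEq] at h
    have hd := sum_sub_sum_shift (powVal (2 * t)) u [] v a b
    simp only [List.nil_append] at hd
    rw [← hx, ← hy] at hd
    have := eq_of_zmod_eq h.1 (by
      rw [hd]; refine (hab a b).trans_lt ?_; push_cast; omega)
    exact hmono.injective (by linarith)
  · intro x y h u a a' w b b' v ha hb hx hy
    simp only [Prod.mk.injEq] at h
    have hl := congrArg List.length hx
    simp at hl
    have hs := sum_sub_sum_two (powVal (2 * t)) u w v a a' b b'
    have hm := moment_sub_moment_two (powVal (2 * t)) u w v a a' b b'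
    rw [← hx, ← hy] at hs hm
    have h1 := eq_of_zmod_eq h.1 (by
      rw [hs]
      refine ((abs_add_le _ _).trans (add_le_add (hab a a') (hab b b'))).trans_lt ?_
      push_cast; omega)
    rw [h1, sub_self] at hs
    -- Equal sums make the two changes opposite, so only the gap between the positions, at most `n`,
    -- enters the moment.
    have hm' : moment (powVal (2 * t)) (List.ofFn x) - moment (powVal (2 * t)) (List.ofFn y) =
        (w.length + 1) * (powVal (2 * t) b - powVal (2 * t) b') := by
      rw [hm, show powVal (2 * t) a - powVal (2 * t) a' =
        -(powVal (2 * t) b - powVal (2 * t) b') by linarith]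
      ring
    have h2 := eq_of_zmod_eq h.2 (by
      rw [hm', abs_mul, abs_of_nonneg (by positivity)]
      push_cast
      refine lt_of_le_of_lt (mul_le_mul (?_ : _ ≤ (n : ℤ)) (hab b b') (abs_nonneg _)
        (by positivity)) (by omega)
      omega)
    rw [h2, sub_self] at hm'
    have := (mul_eq_zero.1 hm'.symm).resolve_left (by positivity)
    exact hb (hmono.injective (by linarith))
  · intro x hxr y h u a w b v hx hy
    rw [mem_richWords] at hxr
    simp only [Prod.mk.injEq] at h
    have hl := congrArg List.length hx
    simp at hl
    have hs := sum_sub_sum_shift (powVal (2 * t)) u w v a b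
    have hm := moment_sub_moment_shift (powVal (2 * t)) u w v a b
    rw [← hx, ← hy] at hs hm
    have h1 := eq_of_zmod_eq h.1 (by
      rw [hs]; refine (hab a b).trans_lt ?_; push_cast; omega)
    obtain rfl : a = b := hmono.injective (by linarith)
    have hsum0 := sum_powVal_nonneg hB w
    have hsum1 : (w.map (powVal (2 * t))).sum ≤ w.length * P := by
      have := List.sum_le_card_nsmul (w.map (powVal (2 * t))) P (by
        intro m hm
        obtain ⟨c, -, rfl⟩ := List.mem_map.1 hm
        exact powVal_le hB c)
      simpa using this
    have hpa : (w.length : ℤ) * powVal (2 * t) a ≤ w.length * P :=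
      mul_le_mul_of_nonneg_left (powVal_le hB a) (by positivity)
    have hpa0 : 0 ≤ (w.length : ℤ) * powVal (2 * t) a :=
      mul_nonneg (by positivity) (powVal_pos hB a).le
    have hwn : (w.length : ℤ) * P ≤ n * P :=
      mul_le_mul_of_nonneg_right (by omega) (by positivity)
    -- With `a = b`, the moments differ by the sum of `w` minus `w.length` times the weight of `a`.
    -- Both terms lie between 0 and `n * P`, so the modulus `n * P + 1` forces them to agree.
    rw [sub_self, mul_zero, zero_add] at hm
    have h2 := eq_of_zmod_eq h.2 (by
      rw [hm, abs_lt]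
      push_cast
      constructor <;> linarith)
    rw [h2, sub_self] at hm
    have hw : IsRich t w := fun s hs => hxr s (hs.trans ⟨u ++ [a], v, by simp [hx]⟩)
    rw [hx, hy, cons_append_eq_of_eq_replicate (hw.eq_replicate htpos (b := a) (by linarith))]

/-! ### Asymptotics -/

theorem tendsto_logb_natCast {q : ℕ} (hq : 2 ≤ q) :
    Tendsto (fun n : ℕ => Real.logb (q : ℝ) (n : ℝ)) atTop atTop :=
  (Real.tendsto_logb_atTop (by exact_mod_cast hq)).comp tendsto_natCast_atTop_atTop

theorem eqAddThetaOne_of_const {g f : ℕ → ℝ} {c : ℝ} (hc : c ≠ 0)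
    (h : ∀ᶠ n in atTop, f n - c ≤ g n ∧ g n ≤ f n + c) : EqAddThetaOne g f :=
  ⟨fun _ => c, isTheta_const_const hc one_ne_zero, h⟩

theorem richLength_le {q n : ℕ} (h : 1 ≤ Real.logb (q : ℝ) (n : ℝ)) :
    (richLength q n : ℝ) ≤ 4 * q ^ 2 * Real.logb q n := by
  have h1 : (Nat.log q n : ℝ) ≤ Real.logb q n := Real.natLog_le_logb n q
  have h2 : (q : ℝ) ^ 2 * (Nat.log q n + 3) ≤ q ^ 2 * (4 * Real.logb q n) :=
    mul_le_mul_of_nonneg_left (by linarith) (by positivity)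
  rw [richLength]
  push_cast
  linarith

theorem eqAddThetaOne_rhoSD_three {q : ℕ} (hq : 2 ≤ q) :
    EqAddThetaOne (fun n => rhoSD q n 3)
      (fun n => Real.logb (q : ℝ) (Real.logb (q : ℝ) (n : ℝ))) := by
  have hq1 : (1 : ℝ) < q := by exact_mod_cast hq
  have hq0 : (0 : ℝ) < q := by linarith
  have h8 : (8 : ℝ) ≤ 8 * q ^ 4 := by
    have : (1 : ℝ) ≤ (q : ℝ) ^ 4 := one_le_pow₀ hq1.le
    linarith
  -- The upper bound has the factor `2 * q ^ 2` times `4 * q ^ 2` from `richLength_le`; the lower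
  -- bound only loses a factor 8.
  refine eqAddThetaOne_of_const (c := Real.logb q (8 * q ^ 4))
    (Real.logb_pos hq1 (by linarith)).ne' ?_
  filter_upwards [(tendsto_logb_natCast hq).eventually_ge_atTop 4] with n hn
  set ℓ := Real.logb (q : ℝ) (n : ℝ) with hℓ
  have hn0 : n ≠ 0 := by
    rintro rfl; simp at hℓ; linarith
  constructor
  · set k := Nat.log q n with hk
    have h1 : ℓ < k + 1 := by
      have h2 : (n : ℝ) < (q : ℝ) ^ (k + 1) := by exact_mod_cast Nat.lt_pow_succ_log_self hq n
      have h3 := Real.logb_lt_logb hq1 (by positivity) h2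
      rw [Real.logb_pow, Real.logb_self_eq_one hq1] at h3
      push_cast at h3
      linarith
    have h2 : (k : ℝ) ≤ 2 * (k / 2 : ℕ) + 1 := by exact_mod_cast (by omega : k ≤ 2 * (k / 2) + 1)
    have h3 : ℓ / 4 ≤ (k / 2 : ℕ) := by linarith
    have hpos : 0 < k / 2 := by
      have : (0 : ℝ) < (k / 2 : ℕ) := by linarith
      exact_mod_cast this
    -- Blocks of half the logarithmic length leave room for the required `q ^ L` disjoint copies.
    have hle : q ^ (k / 2) * (k / 2) ≤ n := by
      calc q ^ (k / 2) * (k / 2) ≤ q ^ (k / 2) * q ^ (k / 2) :=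
            Nat.mul_le_mul_left _ (Nat.lt_pow_self hq).le
        _ = q ^ (k / 2 + k / 2) := (pow_add _ _ _).symm
        _ ≤ q ^ k := Nat.pow_le_pow_right (by omega) (by omega)
        _ ≤ n := Nat.pow_log_le_self q hn0
    refine le_trans ?_ (logb_le_rhoSD_three hq hpos hle)
    have h4 : Real.logb q (ℓ / 8) ≤ Real.logb q ((k / 2 : ℕ) / 2) :=
      Real.logb_le_logb_of_le hq1 (by linarith) (by linarith)
    rw [Real.logb_div (by linarith) (by norm_num)] at h4
    have h5 := Real.logb_le_logb_of_le hq1 (by norm_num) h8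
    linarith
  · refine (rhoSD_three_le hq n).trans ?_
    rw [add_comm, ← Real.logb_mul (by positivity) (by linarith)]
    have hr := richLength_le (q := q) (n := n) (by linarith)
    have hrpos : (0 : ℝ) < richLength q n := by
      have : 0 < richLength q n := by rw [richLength]; positivity
      exact_mod_cast this
    refine Real.logb_le_logb_of_le hq1 (by push_cast; positivity) ?_
    push_cast
    have := mul_le_mul_of_nonneg_left hr (by positivity : (0 : ℝ) ≤ 2 * q ^ 2)
    linarith

theorem eqAddThetaOne_rhoSD_two {N : ℕ} (hN : 0 < N) (hN2 : N ≤ 2) :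
    EqAddThetaOne (fun n => rhoSD 2 n N) (fun n => Real.logb 2 (n : ℝ)) := by
  refine eqAddThetaOne_of_const (c := 2) two_ne_zero ?_
  filter_upwards [eventually_gt_atTop 0] with n hn
  constructor
  · have := logb_le_rhoSD_of_le_two (q := 2) le_rfl hn hN hN2
    push_cast at this
    linarith
  · refine (rhoSD_two_le hN n).trans ?_
    have h4 : Real.logb 2 (2 ^ 2 : ℝ) = 2 := by
      rw [Real.logb_pow, Real.logb_self_eq_one (by norm_num)]; norm_num
    have hn0 : (1 : ℝ) ≤ n := by exact_mod_cast hn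
    have h : Real.logb 2 (n : ℝ) + 2 = Real.logb 2 (n * 2 ^ 2) := by
      rw [Real.logb_mul (by linarith) (by norm_num), h4]
    rw [h]
    refine Real.logb_le_logb_of_le (by norm_num) (by positivity) ?_
    push_cast
    linarith

theorem isBigO_rhoSD_sub_logb {q N : ℕ} (hq : 2 ≤ q) (hN : 0 < N) (hN2 : N ≤ 2) :
    (fun n : ℕ => rhoSD q n N - Real.logb (q : ℝ) (n : ℝ)) =O[atTop]
      (fun n : ℕ => Real.logb (q : ℝ) (Real.logb (q : ℝ) (n : ℝ))) := by
  have hq1 : (1 : ℝ) < q := by exact_mod_cast hq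
  have hq0 : (0 : ℝ) < q := by linarith
  -- The number of classes, doubled, is at most `12 * n * (8 * q ^ 2 * ℓ) ^ (2 * (q - 1))` with `ℓ =
  -- logb q n`. The constants are absorbed because `logb q ℓ ≥ 1`.
  set D : ℝ := Real.logb q 12 + 2 * (q - 1 : ℕ) * (Real.logb q (8 * q ^ 2) + 1) with hD
  refine IsBigO.of_bound D ?_
  filter_upwards [(tendsto_logb_natCast hq).eventually_ge_atTop 1, eventually_gt_atTop 0,
    ((Real.tendsto_logb_atTop hq1).comp (tendsto_logb_natCast hq)).eventually_ge_atTop 1]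
    with n hn hn0 hll
  simp only [Function.comp_apply] at hll
  set ℓ := Real.logb (q : ℝ) (n : ℝ) with hℓ
  have hlow := logb_le_rhoSD_of_le_two hq hn0 hN hN2
  have hup := rhoSD_le_logb_richLength hq hN n
  rw [Real.norm_of_nonneg (by linarith), Real.norm_of_nonneg (by linarith)]
  have hr := richLength_le hn
  have hrpos : 0 < richLength q n := by rw [richLength]; positivity
  set t := richLength q n with ht
  have hP1 : (1 : ℝ) ≤ ((2 * t : ℕ) : ℝ) ^ (q - 1) :=
    one_le_pow₀ (by exact_mod_cast (by omega : 1 ≤ 2 * t))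
  have hPle : ((2 * t : ℕ) : ℝ) ^ (q - 1) ≤ (8 * q ^ 2 * ℓ) ^ (q - 1) :=
    pow_le_pow_left₀ (by positivity) (by push_cast; linarith) _
  set P : ℝ := ((2 * t : ℕ) : ℝ) ^ (q - 1) with hP
  set Q : ℝ := (8 * q ^ 2 * ℓ) ^ (q - 1) with hQ
  have hn1 : (1 : ℝ) ≤ n := by exact_mod_cast hn0
  have hbound : ((2 * ((2 * (2 * t) ^ (q - 1) + 1) * (n * (2 * t) ^ (q - 1) + 1)) : ℕ) : ℝ) ≤
      12 * (n * Q ^ 2) := by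
    have h1 : 1 ≤ n * P := one_le_mul_of_one_le_of_one_le hn1 hP1
    calc ((2 * ((2 * (2 * t) ^ (q - 1) + 1) * (n * (2 * t) ^ (q - 1) + 1)) : ℕ) : ℝ)
        = 2 * ((2 * P + 1) * (n * P + 1)) := by rw [hP]; push_cast; ring
      _ ≤ 2 * ((3 * P) * (2 * (n * P))) := by gcongr <;> linarith
      _ = 12 * (n * P ^ 2) := by ring
      _ ≤ 12 * (n * Q ^ 2) := by gcongr
  have hlog := Real.logb_le_logb_of_le hq1 (by positivity) hbound
  have hℓ0 : 0 < ℓ := by linarith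
  rw [Real.logb_mul (by norm_num) (by positivity), Real.logb_mul (by positivity) (by positivity),
    hQ, ← pow_mul, Real.logb_pow, Real.logb_mul (by positivity) (by positivity)] at hlog
  push_cast at hlog hup
  have h8 : 0 ≤ Real.logb (q : ℝ) (8 * q ^ 2) := by
    refine Real.logb_nonneg hq1 ?_
    have : (1 : ℝ) ≤ (q : ℝ) ^ 2 := one_le_pow₀ hq1.le
    linarith
  have h12 : 0 ≤ Real.logb (q : ℝ) 12 := Real.logb_nonneg hq1 (by norm_num)
  have h3 : Real.logb (q : ℝ) 12 + 2 * (q - 1 : ℕ) * (Real.logb (q : ℝ) (8 * q ^ 2)) ≤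
      (Real.logb (q : ℝ) 12 + 2 * (q - 1 : ℕ) * (Real.logb (q : ℝ) (8 * q ^ 2))) *
        Real.logb q ℓ := le_mul_of_one_le_right (by positivity) hll
  rw [hD]
  linarith

theorem isLittleO_one_sub_rhoSD_two_four :
    (fun n : ℕ => 1 - rhoSD 2 n 4) =o[atTop] (fun _ => (1 : ℝ)) := by
  rw [isLittleO_one_iff]
  have h1 : Tendsto (fun n : ℕ => (2 : ℝ) / 2 ^ (n / 2)) atTop (nhds 0) := by
    refine Tendsto.div_atTop tendsto_const_nhds
      ((tendsto_pow_atTop_atTop_of_one_lt (by norm_num : (1 : ℝ) < 2)).comp ?_)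
    exact Nat.tendsto_div_const_atTop (by norm_num)
  have h2 : Tendsto (fun n : ℕ => (2 : ℝ) / (1 + 2 / 2 ^ (n / 2))) atTop (nhds 2) := by
    have h := (tendsto_const_nhds (x := (2 : ℝ))).div (h1.const_add 1) (by norm_num)
    rwa [add_zero, div_one] at h
  have h3 : Tendsto (fun n : ℕ => 1 - Real.logb 2 (2 / (1 + 2 / 2 ^ (n / 2)))) atTop (nhds 0) := by
    simpa using (h2.logb (b := 2) (by norm_num)).const_sub 1
  refine squeeze_zero (fun n => ?_) (fun n => ?_) h3
  · have := rhoSD_two_four_le n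
    linarith
  · have := logb_le_rhoSD_two_four n
    linarith

theorem mainTheorem10 :
    -- the binary alphabet
    ((∀ N ∈ ({1, 2} : Set ℕ),
        EqAddThetaOne (fun n => rhoSD 2 n N) (fun n => Real.logb 2 (n : ℝ))) ∧
      EqAddThetaOne (fun n => rhoSD 2 n 3) (fun n => Real.logb 2 (Real.logb 2 (n : ℝ))) ∧
      ((∀ n : ℕ, rhoSD 2 n 4 ≤ 1) ∧
        (fun n : ℕ => 1 - rhoSD 2 n 4) =o[atTop] (fun _ => (1 : ℝ))) ∧
      (∀ n N : ℕ, 5 ≤ N → rhoSD 2 n N = 0)) ∧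
    -- alphabets with at least three symbols
    (∀ q : ℕ, 3 ≤ q →
      (∀ N ∈ ({1, 2} : Set ℕ),
        (fun n : ℕ => rhoSD q n N - Real.logb (q : ℝ) (n : ℝ)) =O[atTop]
          (fun n : ℕ => Real.logb (q : ℝ) (Real.logb (q : ℝ) (n : ℝ)))) ∧
      EqAddThetaOne (fun n => rhoSD q n 3)
        (fun n => Real.logb (q : ℝ) (Real.logb (q : ℝ) (n : ℝ))) ∧
      (∀ n : ℕ, 1 ≤ n → 1 ≤ rhoSD q n 4 ∧ rhoSD q n 4 ≤ 2) ∧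
      (∀ n N : ℕ, 1 ≤ n → 5 ≤ N → N ≤ q + 1 → rhoSD q n N = 1) ∧
      (∀ n N : ℕ, q + 2 ≤ N → rhoSD q n N = 0)) := by
  have hN : ∀ N ∈ ({1, 2} : Set ℕ), 0 < N ∧ N ≤ 2 := by
    intro N hN
    simp only [Set.mem_insert_iff, Set.mem_singleton_iff] at hN
    omega
  refine ⟨⟨fun N h => eqAddThetaOne_rhoSD_two (hN N h).1 (hN N h).2, ?_,
    ⟨rhoSD_two_four_le, isLittleO_one_sub_rhoSD_two_four⟩,
    fun n N h => rhoSD_eq_zero le_rfl h (by omega)⟩, fun q hq => ⟨fun N h =>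
    isBigO_rhoSD_sub_logb (by omega) (hN N h).1 (hN N h).2,
    eqAddThetaOne_rhoSD_three (by omega), fun n hn => ⟨one_le_rhoSD (by omega) hn (by omega)
    (by omega), rhoSD_four_le (by omega) n⟩, fun n N hn h5 hNq => le_antisymm
    (rhoSD_le_one (by omega) h5) (one_le_rhoSD (by omega) hn (by omega) hNq),
    fun n N h => rhoSD_eq_zero (by omega) (by omega) h⟩⟩
  exact_mod_cast eqAddThetaOne_rhoSD_three (q := 2) le_rfl
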